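/- Let $N,B,d\ge 1$ be integers. Write $\mathbf x=(\mathbf x_1,\dots,\mathbf x_B)\in\mathbb R^{dB}$ with blocks $\mathbf x_\ell\in\mathbb R^d$, and let $\nabla_\ell$ denote the $\ell$-th block of the gradient. Consider $$\min_{\mathbf x\in\mathcal K}\ U(\mathbf x)=\sum_{i=1}^N f_i(\mathbf x)+\sum_{\ell=1}^B r_\ell(\mathbf x_\ell),\qquad \mathcal K=\mathcal K_1\times\cdots\times\mathcal K_B,$$ where $f_i:\mathbb R^{dB}\to\mathbb R$, $r_\ell:\mathbb R^d\to\mathbb R$ and $\mathcal K_\ell\subseteq\mathbb R^d$. Assume the following. 1. (Problem) Each $\mathcal K_\ell$ is nonempty, closed and convex. Each $f_i$ is $C^1$ on an open set containing $\mathcal K$, and $\nabla f_i$ is Lipschitz continuous and bounded on $\mathcal K$. Each $r_\ell$ is convex on $\mathcal K_\ell$ with bounded subgradients there: for some constant $C_\ell$, at every point of $\mathcal K_\ell$ the function $r_\ell$ has a subgradient of norm at most $C_\ell$, where $g$ is a subgradient of $r_\ell$ at $u$ if $r_\ell(z)\ge r_\ell(u)+g^\top(z-u)$ for all $z\in\mathbb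 R^d$. $U$ is coercive on $\mathcal K$, i.e. $U(\mathbf x)\to\infty$ as $\|\mathbf x\|\to\infty$ with $\mathbf x\in\mathcal K$. 2. (Network) $\mathcal G=(\{1,\dots,N\},\mathcal E)$ is a strongly connected digraph containing all self-loops. An edge $(j,i)\in\mathcal E$ means that agent $j$ can send to agent $i$. 3. (Weights) At time $t$ agent $j$ selects the block $\ell_j^t\in\{1,\dots,B\}$. Put $\mathcal N_{i,\ell}^t=\{j:(j,i)\in\mathcal E,\ \ell_j^t=\ell\}\cup\{i\}$. There is $\kappa>0$ such that for all $t,\ell,i,j$: $a_{ij\ell}^t>\kappa$ if $j\in\mathcal N_{i,\ell}^t$, and $a_{ij\ell}^t=0$ otherwise. Moreover $\sum_i a_{ij\ell}^t=1$ for all $t,\ell,j$. 4. (Block selection) For each agent $i$ there is an integer $T_i>0$ such that $\{\ell_i^{t},\dots,\ell_i^{t+T_i-1}\}=\{1,\dots,B\}$ for all $t\ge 0$. 5. (Surrogates) For all $i,\ell$ and all $\mathbf x\in\mathcal K$, the function $\tilde f_{i,\ell}(\bullet;\mathbf x)$ is differentiable at the points of $\mathcal K_\ell$, and it is strongly convex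 on $\mathcal K_\ell$ with a constant $\tau_i>0$ independent of $\ell$ and $\mathbf x$. With $\nabla\tilde f_{i,\ell}$ the gradient in the first argument, $\nabla\tilde f_{i,\ell}(\mathbf x_\ell;\mathbf x)=\nabla_\ell f_i(\mathbf x)$ for all $\mathbf x\in\mathcal K$, and $\nabla\tilde f_{i,\ell}(z;\bullet)$ is Lipschitz continuous on $\mathcal K$ uniformly in $z\in\mathcal K_\ell$. 6. (Step-sizes) $0<\gamma^t\le 1$, $\gamma^{t+1}\le\gamma^t$, $\sum_t\gamma^t=\infty$ and $\sum_t(\gamma^t)^2<\infty$. Let the sequences $\phi,\mathbf x,\mathbf y$ be generated as follows. Initially $\phi_{(i,\ell)}^0=1$, $\mathbf x_{(i,:)}^0\in\mathcal K$ is arbitrary, and $\mathbf y_{(i,:)}^0=\nabla f_i(\mathbf x_{(i,:)}^0)$. For $t\ge0$, with $\ell=\ell_i^t$, agent $i$ computes $$\widetilde{\mathbf x}_{i}^t=\operatorname*{argmin}_{z\in\mathcal K_{\ell}}\ \tilde f_{i,\ell}(z;\mathbf x_{(i,:)}^t)+\big(N\mathbf y_{(i,\ell)}^t-\nabla_\ell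 f_i(\mathbf x_{(i,:)}^t)\big)^{\top}(z-\mathbf x_{(i,\ell)}^t)+r_\ell(z),$$ and sets $\Delta\mathbf x_{(i,\ell)}^t=\widetilde{\mathbf x}_i^t-\mathbf x_{(i,\ell)}^t$ for $\ell=\ell_i^t$ and $\Delta\mathbf x_{(i,\ell)}^t=0$ for $\ell\ne\ell_i^t$. Then, for every $\ell$, $$\phi_{(i,\ell)}^{t+1}=\sum_{j\in\mathcal N_{i,\ell}^t}a_{ij\ell}^t\phi_{(j,\ell)}^t,\qquad \mathbf x_{(i,\ell)}^{t+1}=\sum_{j\in\mathcal N_{i,\ell}^t}\frac{a_{ij\ell}^t\phi_{(j,\ell)}^t}{\phi_{(i,\ell)}^{t+1}}\big(\mathbf x_{(j,\ell)}^t+\gamma^t\Delta\mathbf x_{(j,\ell)}^t\big),$$ $$\mathbf y_{(i,\ell)}^{t+1}=\sum_{j\in\mathcal N_{i,\ell}^t}\frac{a_{ij\ell}^t}{\phi_{(i,\ell)}^{t+1}}\big(\phi_{(j,\ell)}^t\mathbf y_{(j,\ell)}^t+\nabla_\ell f_j(\mathbf x_{(j,:)}^{t+1})-\nabla_\ell f_j(\mathbf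 x_{(j,:)}^t)\big).$$ Let $\bar{\boldsymbol s}^t=\frac1N\big(\sum_{i=1}^N\phi_{(i,\ell)}^t\mathbf x_{(i,\ell)}^t\big)_{\ell=1}^B$. Then: (i) $\|\mathbf x_{(i,:)}^t-\bar{\boldsymbol s}^t\|\to0$ as $t\to\infty$, for every agent $i$. (ii) The sequence $(\bar{\boldsymbol s}^t)_{t\ge0}$ is bounded, and every limit point $\mathbf s$ of it is a stationary solution of the problem: $\mathbf s\in\mathcal K$, and there is $\xi=(\xi_1,\dots,\xi_B)$, with $\xi_\ell$ a subgradient of $r_\ell$ at $\mathbf s_\ell$ for each $\ell$, such that $\big(\sum_{i=1}^N\nabla f_i(\mathbf s)+\xi\big)^{\top}(\mathbf z-\mathbf s)\ge0$ for all $\mathbf z\in\mathcal K$. -/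

import Mathlib

open Filter Topology
open scoped NNReal

noncomputable section

namespace BlockOpt

/-- One block of the decision variable: `ℝ^d` with the Euclidean norm. -/
abbrev Block (d : ℕ) : Type := EuclideanSpace ℝ (Fin d)

/-- The whole decision variable `x = (x_1, …, x_B) ∈ ℝ^{dB}`, with the Euclidean norm. -/
abbrev BlockVec (B d : ℕ) : Type := PiLp 2 (fun _ : Fin B => Block d)

/-- The feasible set `K = K_1 × ⋯ × K_B`. -/
def feasibleSet {B d : ℕ} (K : Fin B → Set (Block d)) : Set (BlockVec B d) :=
  {x | ∀ l, x l ∈ K l}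

/-- The objective `U(x) = ∑_i f_i(x) + ∑_l r_l(x_l)`. -/
def objective {N B d : ℕ} (f : Fin N → BlockVec B d → ℝ) (r : Fin B → Block d → ℝ)
    (x : BlockVec B d) : ℝ :=
  ∑ i, f i x + ∑ l, r l (x l)

/-- `g` is a subgradient of `r : ℝ^d → ℝ` at `x`. -/
def IsSubgradient {d : ℕ} (r : Block d → ℝ) (x g : Block d) : Prop :=
  ∀ z, r x + inner ℝ g (z - x) ≤ r z

/-- Stationary solutions of `min_{x ∈ K} U(x)`: feasible points `x` for which some subgradient `ξ`
of the nonsmooth term satisfies `⟨∑_i ∇f_i(x) + ξ, z - x⟩ ≥ 0` for all feasible `z`. -/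
def IsStationary {N B d : ℕ} (f : Fin N → BlockVec B d → ℝ) (r : Fin B → Block d → ℝ)
    (K : Fin B → Set (Block d)) (x : BlockVec B d) : Prop :=
  x ∈ feasibleSet K ∧
    ∃ ξ : BlockVec B d, (∀ l, IsSubgradient (r l) (x l) (ξ l)) ∧
      ∀ z ∈ feasibleSet K, 0 ≤ inner ℝ (∑ i, gradient (f i) x + ξ) (z - x)

/-- Assumptions on the optimization problem. -/
structure ProblemAssumptions {N B d : ℕ} (f : Fin N → BlockVec B d → ℝ)
    (r : Fin B → Block d → ℝ) (K : Fin B → Set (Block d)) : Prop where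
  nonempty : ∀ l, (K l).Nonempty
  closed : ∀ l, IsClosed (K l)
  convex : ∀ l, Convex ℝ (K l)
  smooth : ∀ i, ∃ O : Set (BlockVec B d),
    IsOpen O ∧ feasibleSet K ⊆ O ∧ ContDiffOn ℝ 1 (f i) O
  grad_lipschitz : ∀ i, ∃ L : ℝ≥0, LipschitzOnWith L (gradient (f i)) (feasibleSet K)
  grad_bounded : ∀ i, ∃ C : ℝ, ∀ x ∈ feasibleSet K, ‖gradient (f i) x‖ ≤ C
  reg_convex : ∀ l, ConvexOn ℝ (K l) (r l)
  reg_subgradient : ∀ l, ∃ C : ℝ, ∀ x ∈ K l, ∃ g, IsSubgradient (r l) x g ∧ ‖g‖ ≤ C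
  coercive : Tendsto (objective f r) (Bornology.cobounded (BlockVec B d) ⊓ 𝓟 (feasibleSet K)) atTop

/-- The communication digraph (`G.Adj j i`: agent `j` can send to agent `i`) contains all
self-loops and is strongly connected. -/
structure NetworkAssumptions {N : ℕ} (G : Digraph (Fin N)) : Prop where
  self_loop : ∀ i, G.Adj i i
  strongly_connected : ∀ i j, Relation.ReflTransGen G.Adj i j

open Classical in
/-- The block-dependent in-neighbours `{j ∈ N_i | l_j^t = l} ∪ {i}` of agent `i`, where
`sel t j = l_j^t` is the block selected by agent `j` at time `t`. -/
def nbhd {N B : ℕ} (G : Digraph (Fin N)) (sel : ℕ → Fin N → Fin B) (t : ℕ) (l : Fin B)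
    (i : Fin N) : Finset (Fin N) :=
  Finset.univ.filter fun j => (G.Adj j i ∧ sel t j = l) ∨ j = i

/-- The digraph `G_l^t` induced by the transmissions of block `l` at time `t`. -/
def blockGraph {N B : ℕ} (G : Digraph (Fin N)) (sel : ℕ → Fin N → Fin B) (t : ℕ) (l : Fin B) :
    Digraph (Fin N) where
  Adj j i := G.Adj j i ∧ j ∈ nbhd G sel t l i

/-- The weights `a t l i j = a_{ijl}^t` match the digraphs `G_l^t`, with nonzero weights bounded
away from zero, and are column stochastic. -/
structure WeightAssumptions {N B : ℕ} (G : Digraph (Fin N)) (sel : ℕ → Fin N → Fin B)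
    (a : ℕ → Fin B → Matrix (Fin N) (Fin N) ℝ) : Prop where
  lower_bound : ∃ κ : ℝ, 0 < κ ∧ ∀ t l i j, (blockGraph G sel t l).Adj j i → κ < a t l i j
  zero : ∀ t l i j, ¬ (blockGraph G sel t l).Adj j i → a t l i j = 0
  column_stochastic : ∀ t l j, ∑ i, a t l i j = 1

/-- Essentially cyclic block selection: in every window of `T_i` consecutive iterations, agent `i`
selects every block at least once. -/
def EssentiallyCyclic {N B : ℕ} (sel : ℕ → Fin N → Fin B) : Prop :=
  ∀ i, ∃ T : ℕ, 0 < T ∧ ∀ t, ∀ l, ∃ s < T, sel (t + s) i = l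

/-- Assumptions on the surrogates `ft i l z x = f̃_{i,l}(z; x)`. -/
structure SurrogateAssumptions {N B d : ℕ} (f : Fin N → BlockVec B d → ℝ)
    (K : Fin B → Set (Block d)) (ft : Fin N → Fin B → Block d → BlockVec B d → ℝ) : Prop where
  differentiable : ∀ i l, ∀ x ∈ feasibleSet K, ∀ z ∈ K l,
    DifferentiableAt ℝ (fun w => ft i l w x) z
  strongly_convex : ∀ i, ∃ τ : ℝ, 0 < τ ∧ ∀ l, ∀ x ∈ feasibleSet K,
    StrongConvexOn (K l) τ (fun w => ft i l w x)
  grad_consistent : ∀ i l, ∀ x ∈ feasibleSet K,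
    gradient (fun w => ft i l w x) (x l) = gradient (f i) x l
  grad_lipschitz : ∀ i l, ∃ L : ℝ≥0, ∀ z ∈ K l,
    LipschitzOnWith L (fun x => gradient (fun w => ft i l w x) z) (feasibleSet K)

/-- Assumptions on the step-sizes. -/
structure StepAssumptions (γ : ℕ → ℝ) : Prop where
  pos : ∀ t, 0 < γ t
  le_one : ∀ t, γ t ≤ 1
  decreasing : ∀ t, γ (t + 1) ≤ γ t
  sum_infinite : Tendsto (fun n => ∑ t ∈ Finset.range n, γ t) atTop atTop
  sum_sq_finite : Summable fun t => γ t ^ 2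

/-- The function minimized locally by agent `i` over the block `z ∈ K_l`:
`f̃_{i,l}(z; x) + ⟨N y - ∇_l f_i(x), z - x_l⟩ + r_l(z)`. -/
def localObjective {N B d : ℕ} (f : Fin N → BlockVec B d → ℝ) (r : Fin B → Block d → ℝ)
    (ft : Fin N → Fin B → Block d → BlockVec B d → ℝ) (i : Fin N) (l : Fin B)
    (x : BlockVec B d) (y : Block d) (z : Block d) : ℝ :=
  ft i l z x + inner ℝ ((N : ℝ) • y - gradient (f i) x l) (z - x l) + r l z

/-- The direction `Δx_{(i,l)}^t`: `x̃_i^t - x_{(i,l)}^t` on the selected block, `0` elsewhere. -/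
def direction {N B d : ℕ} (sel : ℕ → Fin N → Fin B) (x : ℕ → Fin N → BlockVec B d)
    (xt : ℕ → Fin N → Block d) (t : ℕ) (i : Fin N) (l : Fin B) : Block d :=
  if l = sel t i then xt t i - x t i l else 0

/-- `φ, x, y` (with best responses `xt`) are the sequences generated by the block-wise algorithm
with selection rule `sel`, weights `a` and step-sizes `γ`. -/
structure IsGenerated {N B d : ℕ} (f : Fin N → BlockVec B d → ℝ) (r : Fin B → Block d → ℝ)
    (K : Fin B → Set (Block d)) (G : Digraph (Fin N)) (sel : ℕ → Fin N → Fin B)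
    (a : ℕ → Fin B → Matrix (Fin N) (Fin N) ℝ)
    (ft : Fin N → Fin B → Block d → BlockVec B d → ℝ) (γ : ℕ → ℝ)
    (φ : ℕ → Fin N → Fin B → ℝ) (x y : ℕ → Fin N → BlockVec B d)
    (xt : ℕ → Fin N → Block d) : Prop where
  init_phi : ∀ i l, φ 0 i l = 1
  init_x : ∀ i, x 0 i ∈ feasibleSet K
  init_y : ∀ i, y 0 i = gradient (f i) (x 0 i)
  best_mem : ∀ t i, xt t i ∈ K (sel t i)
  best_min : ∀ t i, IsMinOn
    (localObjective f r ft i (sel t i) (x t i) (y t i (sel t i))) (K (sel t i)) (xt t i)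
  step_phi : ∀ t i l, φ (t + 1) i l = ∑ j ∈ nbhd G sel t l i, a t l i j * φ t j l
  step_x : ∀ t i l, x (t + 1) i l = ∑ j ∈ nbhd G sel t l i,
    (a t l i j * φ t j l / φ (t + 1) i l) • (x t j l + γ t • direction sel x xt t j l)
  step_y : ∀ t i l, y (t + 1) i l = ∑ j ∈ nbhd G sel t l i,
    (a t l i j / φ (t + 1) i l) •
      (φ t j l • y t j l + gradient (f j) (x (t + 1) j) l - gradient (f j) (x t j) l)

/-- The weighted average `s̄^t = (1/N) (∑_i φ_{(i,l)}^t x_{(i,l)}^t)_l`. -/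
def weightedAverage {N B d : ℕ} (φ : ℕ → Fin N → Fin B → ℝ) (x : ℕ → Fin N → BlockVec B d)
    (t : ℕ) : BlockVec B d :=
  WithLp.toLp 2 fun l => (1 / (N : ℝ)) • ∑ i, φ t i l • x t i l

end BlockOpt

end

/-! The argument separates network errors from optimization.

Network. Rewritten with the row-stochastic weights `mixing`, both the `x` and the `y` updates are
perturbed consensus recursions. Essentially cyclic selection activates every edge of the strongly
connected digraph, for each block, in windows of fixed length. Products of mixing matrices over long
windows therefore have entries bounded below, and the spread contracts up to the perturbation
(`exists_spread_contraction`). Bounded gradients break the circular dependence between `x` and `y`: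
they bound `y`, hence the directions, so the perturbation of `x` is O(γ) and square summable. The
spread of `x` and the increments of `x` are then square summable, hence so is the perturbation of
`y`. Column stochasticity preserves the φ-weighted sums, so `N y` tracks the total gradient at the
weighted average with square-summable error (`Run.exists_error`).

Descent. `lyapunov` averages the regularizers over the local copies instead of evaluating them at
the weighted average. By convexity mixing cannot increase this average, and no consensus error of
first order appears. Strong convexity of the surrogates makes `lyapunov` decrease by a multiple of
γ‖Δ‖², up to summable errors γe and γ² (`Run.exists_lyapunov_descent`). Hence ∑ γ‖Δ‖² is finite, and
coercivity bounds the weighted averages.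

Stationarity. For one fixed agent and block, take the distance from the weighted average to its
exact response, computed with the true total gradient. Each window contains a time at which the
block is selected, and there the distance is controlled by ‖Δ‖ and the errors. So its square is
summable against γ, while its increments are O(γ); this forces it to zero
(`tendsto_zero_of_weighted_sq_summable`). By continuity it vanishes at limit points. What remains is
a variational inequality containing `r`, and Hahn–Banach turns it into one with a global subgradient
(`exists_global_subgradient`). -/

namespace BlockOpt

/-! ### Scalar recursions and summability. -/

section Sequences

/-- A nonnegative sequence contracting over windows of fixed length, up to a summable error, is
summable. -/
theorem summable_of_delayed_contraction {b c : ℕ → ℝ} {ρ : ℝ} {m : ℕ} (hb : ∀ t, 0 ≤ b t)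
    (hc0 : ∀ t, 0 ≤ c t) (hρ : ρ < 1) (hc : Summable c)
    (h : ∀ t, b (t + m) ≤ ρ * b t + c t) : Summable b := by
  -- Summing the recursion bounds each partial sum by its first m terms, plus ρ times itself, plus
  -- the total error; solving for it gives this constant.
  refine summable_of_sum_range_le (c := (∑ t ∈ Finset.range m, b t + ∑' t, c t) / (1 - ρ)) hb
    fun n => ?_
  rw [le_div_iff₀ (by linarith)]
  have h1 : ∑ t ∈ Finset.range n, b t ≤ ∑ t ∈ Finset.range (m + n), b t :=
    Finset.sum_le_sum_of_subset_of_nonneg (Finset.range_mono (by omega)) fun _ _ _ => hb _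
  rw [Finset.sum_range_add] at h1
  have h2 : ∑ t ∈ Finset.range n, b (m + t)
      ≤ ρ * ∑ t ∈ Finset.range n, b t + ∑ t ∈ Finset.range n, c t := by
    rw [Finset.mul_sum, ← Finset.sum_add_distrib]
    exact Finset.sum_le_sum fun t _ => by rw [add_comm m t]; exact h t
  have h3 := hc.sum_le_tsum (Finset.range n) fun _ _ => hc0 _
  linarith

/-- Square summability version of `summable_of_delayed_contraction`. -/
theorem summable_sq_of_delayed_contraction {b c : ℕ → ℝ} {ρ : ℝ} {m : ℕ} (hb : ∀ t, 0 ≤ b t)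
    (hρ0 : 0 ≤ ρ) (hρ : ρ < 1) (hc : Summable fun t => c t ^ 2)
    (h : ∀ t, b (t + m) ≤ ρ * b t + c t) : Summable fun t => b t ^ 2 := by
  -- Convexity of the square, with ρ b + c read as the convex combination ρ b + (1 - ρ) (c / (1 -
  -- ρ)), gives this error term.
  refine summable_of_delayed_contraction (c := fun t => c t ^ 2 / (1 - ρ)) (ρ := ρ) (m := m)
    (fun _ => sq_nonneg _) (fun t => div_nonneg (sq_nonneg _) (by linarith)) hρ (hc.div_const _)
    fun t => ?_
  have h1 : b (t + m) ^ 2 ≤ (ρ * b t + c t) ^ 2 := pow_le_pow_left₀ (hb _) (h t) 2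
  have h2 : 0 < 1 - ρ := by linarith
  have h3 : ρ * b t ^ 2 + c t ^ 2 / (1 - ρ) - (ρ * b t + c t) ^ 2
      = ρ * ((1 - ρ) * b t - c t) ^ 2 / (1 - ρ) := by
    field_simp
    ring
  have h4 : 0 ≤ ρ * ((1 - ρ) * b t - c t) ^ 2 / (1 - ρ) := by positivity
  linarith

/-- A sequence contracting over windows of fixed length, up to a bounded error, is bounded. -/
theorem bounded_of_delayed_contraction {b : ℕ → ℝ} {ρ c : ℝ} {m : ℕ} (hm : 0 < m)
    (hρ0 : 0 ≤ ρ) (hρ : ρ < 1) (h : ∀ t, b (t + m) ≤ ρ * b t + c) : ∃ M, ∀ t, b t ≤ M := by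
  have h2 : 0 < 1 - ρ := by linarith
  refine ⟨max (∑ t ∈ Finset.range m, |b t|) (c / (1 - ρ)), fun t => ?_⟩
  induction t using Nat.strong_induction_on with
  | _ t ih =>
    rcases lt_or_ge t m with htm | htm
    · refine le_max_of_le_left ((le_abs_self _).trans ?_)
      exact Finset.single_le_sum (f := fun t => |b t|) (fun _ _ => abs_nonneg _)
        (Finset.mem_range.2 htm)
    · obtain ⟨s, rfl⟩ := Nat.exists_eq_add_of_le' htm
      have h1 := ih s (by omega)
      set M := max (∑ t ∈ Finset.range m, |b t|) (c / (1 - ρ))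
      have h3 : c ≤ M * (1 - ρ) := (div_le_iff₀ h2).1 (le_max_right _ _)
      have := h s
      have := mul_le_mul_of_nonneg_left h1 hρ0
      linarith

/-- Almost-supermartingale lemma for deterministic sequences. -/
theorem summable_and_bounded_of_descent {V a b : ℕ → ℝ} {v : ℝ} (ha : ∀ t, 0 ≤ a t)
    (hb0 : ∀ t, 0 ≤ b t) (hb : Summable b) (hv : ∀ t, v ≤ V t)
    (h : ∀ t, V (t + 1) ≤ V t - a t + b t) : Summable a ∧ ∃ M, ∀ t, V t ≤ M := by
  have key : ∀ n, V n + ∑ t ∈ Finset.range n, a t ≤ V 0 + ∑ t ∈ Finset.range n, b t := by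
    intro n
    induction n with
    | zero => simp
    | succ n ih =>
      rw [Finset.sum_range_succ, Finset.sum_range_succ]
      linarith [h n]
  have hbn := fun n => hb.sum_le_tsum (Finset.range n) fun _ _ => hb0 _
  refine ⟨summable_of_sum_range_le (c := V 0 + ∑' t, b t - v) ha fun n => ?_,
    V 0 + ∑' t, b t, fun n => ?_⟩
  · linarith [key n, hbn n, hv n]
  · linarith [key n, hbn n, Finset.sum_nonneg fun t (_ : t ∈ Finset.range n) => ha t]

/-- A nonnegative sequence that is square summable against a non-summable weight and whose
increments are bounded by the weight tends to zero. -/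
theorem tendsto_zero_of_weighted_sq_summable {γ a : ℕ → ℝ} {C : ℝ} (hγ : ∀ t, 0 ≤ γ t)
    (hγ1 : ∀ t, γ t ≤ 1)
    (hdiv : Tendsto (fun n => ∑ t ∈ Finset.range n, γ t) atTop atTop)
    (hsq : Summable fun t => γ t ^ 2) (ha : ∀ t, 0 ≤ a t)
    (hsum : Summable fun t => γ t * a t ^ 2) (hinc : ∀ t, |a (t + 1) - a t| ≤ C * γ t) :
    Tendsto a atTop (𝓝 0) := by
  have hC : ∀ t, 0 ≤ C * γ t := fun t => (abs_nonneg _).trans (hinc t)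
  -- Cubes are used because the increment of a³ carries the factor γ a², which is summable, plus
  -- higher powers of γ. So a³ has bounded variation and converges.
  have hcub : Summable fun t => |a (t + 1) ^ 3 - a t ^ 3| := by
    refine Summable.of_nonneg_of_le (fun _ => abs_nonneg _) (fun t => ?_)
      (((hsum.mul_left (6 * |C|)).add (hsq.mul_left (6 * |C| ^ 3))))
    have hCt : C * γ t ≤ |C| * γ t := mul_le_mul_of_nonneg_right (le_abs_self C) (hγ t)
    have h1 := hinc t
    have e : a (t + 1) ^ 3 - a t ^ 3
        = (a (t + 1) - a t) * (3 * a t ^ 2 + 3 * a t * (a (t + 1) - a t)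
          + (a (t + 1) - a t) ^ 2) := by ring
    rw [e, abs_mul]
    set D := a (t + 1) - a t
    have hD2 : D ^ 2 ≤ (|C| * γ t) ^ 2 := by
      rw [← sq_abs D]; exact pow_le_pow_left₀ (abs_nonneg _) (h1.trans hCt) 2
    have h2 : |3 * a t ^ 2 + 3 * a t * D + D ^ 2| ≤ 6 * a t ^ 2 + 6 * (|C| * γ t) ^ 2 := by
      rw [abs_le]
      constructor <;> nlinarith [sq_nonneg (a t + D), sq_nonneg (a t - D), sq_nonneg (a t)]
    have h3 : γ t ^ 3 ≤ γ t ^ 2 := pow_le_pow_of_le_one (hγ t) (hγ1 t) (by norm_num)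
    calc |D| * |3 * a t ^ 2 + 3 * a t * D + D ^ 2|
        ≤ (|C| * γ t) * (6 * a t ^ 2 + 6 * (|C| * γ t) ^ 2) :=
          mul_le_mul (h1.trans hCt) h2 (abs_nonneg _) ((hC t).trans hCt)
      _ = 6 * |C| * (γ t * a t ^ 2) + 6 * |C| ^ 3 * γ t ^ 3 := by ring
      _ ≤ _ := by gcongr
  have hcauchy : CauchySeq fun t => a t ^ 3 := by
    refine cauchySeq_of_summable_dist (hcub.congr fun t => ?_)
    rw [Nat.succ_eq_add_one, dist_comm, Real.dist_eq]
  obtain ⟨A, hA⟩ := cauchySeq_tendsto_of_complete hcauchy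
  have hA0 : 0 ≤ A := ge_of_tendsto' hA fun t => pow_nonneg (ha t) 3
  have hAz : A = 0 := by
    by_contra hne
    have hpos : 0 < A := lt_of_le_of_ne hA0 (Ne.symm hne)
    -- A positive limit keeps a² above δ: either a > 1, or a² ≥ a³ ≥ A / 2. Then γ itself would be
    -- summable.
    set δ := min 1 (A / 2)
    have hδ : 0 < δ := lt_min one_pos (by linarith)
    have hev : ∀ᶠ t in atTop, δ ≤ a t ^ 2 := by
      filter_upwards [hA.eventually_const_le (show A / 2 < A by linarith)] with t ht
      rcases le_or_gt 1 (a t) with h1 | h1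
      · exact (min_le_left _ _).trans (by nlinarith)
      · exact (min_le_right _ _).trans
          (ht.trans (pow_le_pow_of_le_one (ha t) h1.le (by norm_num)))
    obtain ⟨n0, hn0⟩ := eventually_atTop.1 hev
    have hs : Summable fun t => γ (t + n0) := by
      refine Summable.of_nonneg_of_le (fun t => hγ _) (fun t => ?_)
        (((summable_nat_add_iff n0).2 hsum).mul_left δ⁻¹)
      have := mul_le_mul_of_nonneg_left (hn0 (t + n0) (by omega)) (hγ (t + n0))
      rw [inv_mul_eq_div, le_div_iff₀ hδ]
      exact this
    have hs' : Summable γ := (summable_nat_add_iff n0).1 hs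
    exact not_tendsto_nhds_of_tendsto_atTop hdiv _ hs'.hasSum.tendsto_sum_nat
  rw [hAz] at hA
  have hroot : Tendsto (fun t => (a t ^ 3) ^ ((1 : ℝ) / 3)) atTop (𝓝 ((0 : ℝ) ^ ((1 : ℝ) / 3))) :=
    hA.rpow_const (Or.inr (by norm_num))
  rw [Real.zero_rpow (by norm_num)] at hroot
  refine hroot.congr fun t => ?_
  rw [← Real.rpow_natCast, ← Real.rpow_mul (ha t)]
  norm_num

theorem summable_sq_add {a b : ℕ → ℝ} (ha : Summable fun t => a t ^ 2)
    (hb : Summable fun t => b t ^ 2) : Summable fun t => (a t + b t) ^ 2 := by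
  refine Summable.of_nonneg_of_le (fun _ => sq_nonneg _) (fun t => ?_)
    ((ha.mul_left 2).add (hb.mul_left 2))
  nlinarith [sq_nonneg (a t - b t)]

theorem summable_sq_const_mul {a : ℕ → ℝ} (c : ℝ) (ha : Summable fun t => a t ^ 2) :
    Summable fun t => (c * a t) ^ 2 := by
  simpa only [mul_pow] using ha.mul_left (c ^ 2)

theorem summable_sq_sum {ι : Type*} (s : Finset ι) {a : ι → ℕ → ℝ}
    (ha : ∀ i ∈ s, Summable fun t => a i t ^ 2) : Summable fun t => (∑ i ∈ s, a i t) ^ 2 := by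
  classical
  induction s using Finset.induction_on with
  | empty => simp
  | insert i s hi ih =>
    simp only [Finset.sum_insert hi]
    exact summable_sq_add (ha i (by simp)) (ih fun j hj => ha j (by simp [hj]))

theorem summable_mul_of_sq {a b : ℕ → ℝ} (ha0 : ∀ t, 0 ≤ a t) (hb0 : ∀ t, 0 ≤ b t)
    (ha : Summable fun t => a t ^ 2) (hb : Summable fun t => b t ^ 2) :
    Summable fun t => a t * b t := by
  refine Summable.of_nonneg_of_le (fun t => mul_nonneg (ha0 t) (hb0 t)) (fun t => ?_) (ha.add hb)
  nlinarith [sq_nonneg (a t - b t), ha0 t, hb0 t, mul_nonneg (ha0 t) (hb0 t)]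

theorem tendsto_zero_of_summable_sq {a : ℕ → ℝ} (ha : Summable fun t => a t ^ 2) :
    Tendsto a atTop (𝓝 0) := by
  have h := ha.tendsto_atTop_zero.sqrt
  simp only [Real.sqrt_sq_eq_abs, Real.sqrt_zero] at h
  exact (tendsto_zero_iff_abs_tendsto_zero _).2 h

end Sequences

/-! ### Products of stochastic matrices and contraction of the spread. -/

section Consensus

variable {n : Type*} [Fintype n] [DecidableEq n]

/-- The product `W (t + m - 1) ⋯ W t`. -/
def transition (W : ℕ → Matrix n n ℝ) (t : ℕ) : ℕ → Matrix n n ℝ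
  | 0 => 1
  | m + 1 => W (t + m) * transition W t m

theorem transition_add (W : ℕ → Matrix n n ℝ) (t m k : ℕ) :
    transition W t (m + k) = transition W (t + m) k * transition W t m := by
  induction k with
  | zero => simp [transition]
  | succ k ih => rw [← add_assoc, transition, transition, ih, Matrix.mul_assoc, add_assoc]

theorem transition_nonneg {W : ℕ → Matrix n n ℝ} (hW : ∀ t i j, 0 ≤ W t i j) (t m : ℕ) (i j : n) :
    0 ≤ transition W t m i j := by
  induction m generalizing i j with
  | zero => rw [transition, Matrix.one_apply]; split_ifs <;> norm_num
  | succ m ih =>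
    rw [transition, Matrix.mul_apply]
    exact Finset.sum_nonneg fun k _ => mul_nonneg (hW _ _ _) (ih _ _)

omit [DecidableEq n] in
theorem mul_entry_le {A C : Matrix n n ℝ} (hA : ∀ i j, 0 ≤ A i j) (hC : ∀ i j, 0 ≤ C i j)
    (i k j : n) : A i k * C k j ≤ (A * C) i j := by
  rw [Matrix.mul_apply]
  exact Finset.single_le_sum (f := fun k => A i k * C k j)
    (fun k _ => mul_nonneg (hA _ _) (hC _ _)) (Finset.mem_univ k)

theorem pow_le_transition_diag {W : ℕ → Matrix n n ℝ} (hW : ∀ t i j, 0 ≤ W t i j) {κ : ℝ}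
    (hκ : 0 ≤ κ) (hdiag : ∀ t i, κ ≤ W t i i) (t m : ℕ) (i : n) :
    κ ^ m ≤ transition W t m i i := by
  induction m with
  | zero => simp [transition]
  | succ m ih =>
    rw [pow_succ']
    exact (mul_le_mul (hdiag _ _) ih (pow_nonneg hκ _) (hW _ _ _)).trans
      (mul_entry_le (hW _) (transition_nonneg hW t m) i i i)

/-- If every edge of a strongly connected relation is active in every window of some length, all
long enough products have entries bounded away from zero. -/
theorem exists_pow_le_transition {W : ℕ → Matrix n n ℝ} (hW : ∀ t i j, 0 ≤ W t i j) {κ : ℝ}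
    (hκ : 0 < κ) (hdiag : ∀ t i, κ ≤ W t i i) {R : n → n → Prop}
    (hR : ∀ j i, R j i → ∃ T, ∀ t, ∃ s < T, κ ≤ W (t + s) i j)
    (hconn : ∀ i j, Relation.ReflTransGen R i j) :
    ∃ m, 0 < m ∧ ∀ t i j, κ ^ m ≤ transition W t m i j := by
  have hnn := transition_nonneg hW
  -- Mass waits at j until the edge is active, crosses it, then waits at i; the diagonal lower bound
  -- pays for the waiting. Having the bound for every m ≥ T is what later allows one m for all
  -- pairs.
  have hedge : ∀ j i, R j i → ∃ T, ∀ m, T ≤ m → ∀ t, κ ^ m ≤ transition W t m i j := by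
    intro j i hji
    obtain ⟨T, hT⟩ := hR j i hji
    refine ⟨T, fun m hm t => ?_⟩
    obtain ⟨s, hs, hκs⟩ := hT t
    obtain ⟨k, rfl⟩ := Nat.exists_eq_add_of_le (show s + 1 ≤ m by omega)
    have h1 : κ ^ (s + 1) ≤ transition W t (s + 1) i j := by
      rw [pow_succ']
      exact (mul_le_mul hκs (pow_le_transition_diag hW hκ.le hdiag t s j) (by positivity)
        (hW _ _ _)).trans (mul_entry_le (hW _) (hnn t s) i j j)
    rw [transition_add, add_comm (s + 1) k, pow_add]
    exact (mul_le_mul (pow_le_transition_diag hW hκ.le hdiag (t + (s + 1)) k i) h1 (by positivity)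
      (hnn _ _ _ _)).trans (mul_entry_le (hnn _ _) (hnn _ _) i i j)
  have hpath : ∀ j i, ∃ T, ∀ m, T ≤ m → ∀ t, κ ^ m ≤ transition W t m i j := by
    intro j i
    induction hconn j i with
    | refl => exact ⟨0, fun m _ t => pow_le_transition_diag hW hκ.le hdiag t m j⟩
    | @tail k i _ hki ih =>
      obtain ⟨T₁, h₁⟩ := ih
      obtain ⟨T₂, h₂⟩ := hedge k i hki
      refine ⟨T₁ + T₂, fun m hm t => ?_⟩
      obtain ⟨q, rfl⟩ := Nat.exists_eq_add_of_le (show T₁ ≤ m by omega)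
      rw [transition_add, add_comm T₁ q, pow_add]
      exact (mul_le_mul (h₂ q (by omega) (t + T₁)) (h₁ T₁ le_rfl t) (by positivity)
        (hnn _ _ _ _)).trans (mul_entry_le (hnn _ _) (hnn _ _) i k j)
  choose T hT using hpath
  -- The sum serves as a common upper bound for all the `T j i`; the extra 1 makes the window
  -- nonempty.
  refine ⟨∑ j, ∑ i, T j i + 1, by omega, fun t i j => hT j i _ ?_ t⟩
  have h1 : T j i ≤ ∑ i, T j i :=
    Finset.single_le_sum (f := fun i => T j i) (fun _ _ => Nat.zero_le _) (Finset.mem_univ i)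
  have h2 : ∑ i, T j i ≤ ∑ j, ∑ i, T j i :=
    Finset.single_le_sum (f := fun j => ∑ i, T j i) (fun _ _ => Nat.zero_le _) (Finset.mem_univ j)
  omega

theorem transition_row_sum {W : ℕ → Matrix n n ℝ} (hW : ∀ t i, ∑ j, W t i j = 1) (t m : ℕ)
    (i : n) : ∑ j, transition W t m i j = 1 := by
  induction m generalizing i with
  | zero => simp [transition, Matrix.one_apply]
  | succ m ih =>
    simp only [transition, Matrix.mul_apply]
    rw [Finset.sum_comm]
    simp only [← Finset.mul_sum, ih, mul_one, hW]

variable {E : Type*} [NormedAddCommGroup E] [NormedSpace ℝ E]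

/-- The largest distance between two members of a family. -/
noncomputable def spread (z : n → E) : ℝ := Metric.diam (Set.range z)

omit [DecidableEq n] [NormedSpace ℝ E] in
theorem norm_sub_le_spread (z : n → E) (i j : n) : ‖z i - z j‖ ≤ spread z := by
  rw [← dist_eq_norm]
  exact Metric.dist_le_diam_of_mem (Set.finite_range z).isBounded ⟨i, rfl⟩ ⟨j, rfl⟩

omit [Fintype n] [DecidableEq n] [NormedSpace ℝ E] in
theorem spread_nonneg (z : n → E) : 0 ≤ spread z := Metric.diam_nonneg

omit [Fintype n] [DecidableEq n] [NormedSpace ℝ E] in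
theorem spread_le {z : n → E} {c : ℝ} (hc : 0 ≤ c) (h : ∀ i j, ‖z i - z j‖ ≤ c) :
    spread z ≤ c := by
  refine Metric.diam_le_of_forall_dist_le hc ?_
  rintro _ ⟨i, rfl⟩ _ ⟨j, rfl⟩
  rw [dist_eq_norm]
  exact h i j

omit [DecidableEq n] in
theorem norm_sub_weighted_sum_le_spread {w : n → ℝ} (hw : ∀ j, 0 ≤ w j) (hw1 : ∑ j, w j = 1)
    (z : n → E) (i : n) : ‖z i - ∑ j, w j • z j‖ ≤ spread z := by
  have e : z i - ∑ j, w j • z j = ∑ j, w j • (z i - z j) := by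
    simp only [smul_sub, Finset.sum_sub_distrib, ← Finset.sum_smul, hw1, one_smul]
  rw [e]
  calc ‖∑ j, w j • (z i - z j)‖ ≤ ∑ j, w j * spread z := by
        refine norm_sum_le_of_le _ fun j _ => ?_
        rw [norm_smul, Real.norm_of_nonneg (hw j)]
        exact mul_le_mul_of_nonneg_left (norm_sub_le_spread z i j) (hw j)
    _ = spread z := by rw [← Finset.sum_mul, hw1, one_mul]

omit [DecidableEq n] in
/-- Averages with weights bounded below by `η` contract the spread. -/
theorem norm_weighted_sub_le {p q : n → ℝ} {η : ℝ} (hp : ∀ j, η ≤ p j) (hq : ∀ j, η ≤ q j)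
    (hp1 : ∑ j, p j = 1) (hq1 : ∑ j, q j = 1) (hρ : 0 < 1 - Fintype.card n * η) (z : n → E) :
    ‖∑ j, p j • z j - ∑ j, q j • z j‖ ≤ (1 - Fintype.card n * η) * spread z := by
  set ρ := 1 - Fintype.card n * η with hρdef
  have hsum : ∀ p : n → ℝ, ∑ j, p j = 1 → ∑ j, (p j - η) = ρ := by
    intro p hp1
    rw [Finset.sum_sub_distrib, hp1, Finset.sum_const, Finset.card_univ, nsmul_eq_mul]
  -- Removing the common part η leaves two nonnegative weight families of equal mass ρ. Coupling
  -- them by their product expresses the difference through pairwise differences of z.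
  have key : ρ • (∑ j, p j • z j - ∑ j, q j • z j)
      = ∑ i, ∑ j, ((p i - η) * (q j - η)) • (z i - z j) := by
    simp only [smul_sub, Finset.sum_sub_distrib]
    have e1 : ∑ i, ∑ j, ((p i - η) * (q j - η)) • z i = ρ • ∑ i, (p i - η) • z i := by
      simp only [← Finset.sum_smul, ← Finset.mul_sum, hsum q hq1, Finset.smul_sum, smul_smul]
      simp only [mul_comm]
    have e2 : ∑ i, ∑ j, ((p i - η) * (q j - η)) • z j = ρ • ∑ j, (q j - η) • z j := by
      rw [Finset.sum_comm]
      simp only [← Finset.sum_smul, ← Finset.sum_mul, hsum p hp1, Finset.smul_sum, smul_smul]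
    rw [e1, e2, ← smul_sub, ← smul_sub]
    simp only [sub_smul, Finset.sum_sub_distrib, sub_sub_sub_cancel_right]
  have hbound : ρ * ‖∑ j, p j • z j - ∑ j, q j • z j‖ ≤ ρ * (ρ * spread z) := by
    rw [← Real.norm_of_nonneg hρ.le, ← norm_smul, key, Real.norm_of_nonneg hρ.le]
    calc ‖∑ i, ∑ j, ((p i - η) * (q j - η)) • (z i - z j)‖
        ≤ ∑ i, ∑ j, (p i - η) * (q j - η) * spread z := by
          refine norm_sum_le_of_le _ fun i _ => norm_sum_le_of_le _ fun j _ => ?_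
          have h0 := mul_nonneg (sub_nonneg.2 (hp i)) (sub_nonneg.2 (hq j))
          rw [norm_smul, Real.norm_of_nonneg h0]
          exact mul_le_mul_of_nonneg_left (norm_sub_le_spread z i j) h0
      _ = ρ * (ρ * spread z) := by
          simp only [← Finset.sum_mul, ← Finset.mul_sum, hsum q hq1, hsum p hp1, mul_assoc]
  exact le_of_mul_le_mul_left hbound hρ

/-- Perturbed consensus: contraction of the spread over windows. -/
theorem exists_spread_contraction [Nonempty n] {W : ℕ → Matrix n n ℝ}
    (hW : ∀ t i j, 0 ≤ W t i j) (hrow : ∀ t i, ∑ j, W t i j = 1) {κ : ℝ}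
    (hκ : 0 < κ) (hdiag : ∀ t i, κ ≤ W t i i) {R : n → n → Prop}
    (hR : ∀ j i, R j i → ∃ T, ∀ t, ∃ s < T, κ ≤ W (t + s) i j)
    (hconn : ∀ i j, Relation.ReflTransGen R i j) :
    ∃ ρ : ℝ, 0 ≤ ρ ∧ ρ < 1 ∧ ∃ m, 0 < m ∧ ∀ (z u : ℕ → n → E) (ε : ℕ → ℝ),
      (∀ t i, z (t + 1) i = ∑ j, W t i j • (z t j + u t j)) → (∀ t j, ‖u t j‖ ≤ ε t) →
      ∀ t, spread (z (t + m)) ≤ ρ * spread (z t) + 2 * ∑ s ∈ Finset.range m, ε (t + s) := by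
  obtain ⟨m, hm, hpow⟩ := exists_pow_le_transition hW hκ hdiag hR hconn
  have hcard : (0 : ℝ) < Fintype.card n := by exact_mod_cast Fintype.card_pos
  -- Halving keeps 1 - card n * η strictly positive, as `norm_weighted_sub_le` requires, even when
  -- card n * κ ^ m = 1.
  set η := κ ^ m / 2 with hη
  have hη0 : 0 < η := by positivity
  have hη1 : Fintype.card n * κ ^ m ≤ 1 := by
    rw [← transition_row_sum hrow 0 m (Classical.arbitrary n)]
    calc (Fintype.card n : ℝ) * κ ^ m = ∑ _j : n, κ ^ m := by simp
      _ ≤ _ := Finset.sum_le_sum fun j _ => hpow _ _ _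
  have hρ : 0 < 1 - Fintype.card n * η := by rw [hη]; linarith
  refine ⟨1 - Fintype.card n * η, hρ.le, by nlinarith, m, hm, fun z u ε hz hu t => ?_⟩
  have hε : ∀ t, 0 ≤ ε t := fun t => (norm_nonneg _).trans (hu t (Classical.arbitrary n))
  -- Since rows sum to one, each perturbation passes through later mixing without growing. Applied
  -- to two agents, this is the source of the factor 2.
  have hdev : ∀ k i, ‖z (t + k) i - ∑ j, transition W t k i j • z t j‖
      ≤ ∑ s ∈ Finset.range k, ε (t + s) := by
    intro k
    induction k with
    | zero => intro i; simp [transition, Matrix.one_apply]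
    | succ k ih =>
      intro i
      have e : z (t + (k + 1)) i - ∑ j, transition W t (k + 1) i j • z t j
          = ∑ q, W (t + k) i q • ((z (t + k) q - ∑ j, transition W t k q j • z t j)
            + u (t + k) q) := by
        rw [← add_assoc, hz]
        have : ∑ j, transition W t (k + 1) i j • z t j
            = ∑ q, W (t + k) i q • ∑ j, transition W t k q j • z t j := by
          simp only [transition, Matrix.mul_apply, Finset.sum_smul, Finset.smul_sum, smul_smul]
          exact Finset.sum_comm
        rw [this, ← Finset.sum_sub_distrib]
        refine Finset.sum_congr rfl fun q _ => ?_
        rw [← smul_sub]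
        congr 1
        abel
      rw [e, Finset.sum_range_succ]
      calc _ ≤ ∑ q, W (t + k) i q * (∑ s ∈ Finset.range k, ε (t + s) + ε (t + k)) := by
            refine norm_sum_le_of_le _ fun q _ => ?_
            rw [norm_smul, Real.norm_of_nonneg (hW _ _ _)]
            exact mul_le_mul_of_nonneg_left (norm_add_le_of_le (ih q) (hu _ _)) (hW _ _ _)
        _ = _ := by rw [← Finset.sum_mul, hrow, one_mul]
  have hη2 : η ≤ κ ^ m := by rw [hη]; linarith
  refine spread_le ?_ fun i j => ?_
  · exact add_nonneg (mul_nonneg hρ.le (spread_nonneg _))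
      (mul_nonneg zero_le_two (Finset.sum_nonneg fun _ _ => hε _))
  · have h1 := norm_weighted_sub_le (fun q => hη2.trans (hpow t i q))
      (fun q => hη2.trans (hpow t j q)) (transition_row_sum hrow t m i)
      (transition_row_sum hrow t m j) hρ (z t)
    have h2 := hdev m i
    have h3 := hdev m j
    have e : z (t + m) i - z (t + m) j
        = (∑ q, transition W t m i q • z t q - ∑ q, transition W t m j q • z t q)
          + (z (t + m) i - ∑ q, transition W t m i q • z t q)
          - (z (t + m) j - ∑ q, transition W t m j q • z t q) := by abel
    rw [e]
    refine (norm_sub_le _ _).trans ?_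
    have := norm_add_le (∑ q, transition W t m i q • z t q - ∑ q, transition W t m j q • z t q)
      (z (t + m) i - ∑ q, transition W t m i q • z t q)
    linarith

end Consensus

/-! ### First-order conditions and a subdifferential sum rule. -/

section ConvexAnalysis

variable {E : Type*} [NormedAddCommGroup E] [InnerProductSpace ℝ E]

/-- One-sided difference quotients of a differentiable function along a segment. -/
theorem tendsto_slope_gradient [CompleteSpace E] {g : E → ℝ} {z : E}
    (hg : DifferentiableAt ℝ g z) (v : E) :
    Tendsto (fun θ : ℝ => (g (z + θ • v) - g z) / θ) (𝓝[>] 0) (𝓝 (inner ℝ (gradient g z) v)) := by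
  have h1 : HasDerivAt (fun θ : ℝ => g (z + θ • v)) (inner ℝ (gradient g z) v) 0 := by
    have hl : HasDerivAt (fun θ : ℝ => z + θ • v) v 0 := by
      simpa using ((hasDerivAt_id (0 : ℝ)).smul_const v).const_add z
    have hf : HasFDerivAt g (InnerProductSpace.toDual ℝ E (gradient g z)) (z + (0 : ℝ) • v) := by
      simpa using hg.hasGradientAt.hasFDerivAt
    have h := hf.comp_hasDerivAt (0 : ℝ) hl
    rwa [InnerProductSpace.toDual_apply_apply] at h
  have h2 := h1.tendsto_slope_zero_right
  refine h2.congr fun θ => ?_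
  simp [div_eq_inv_mul]

/-- First-order lower bound for strongly convex functions. -/
theorem strongConvexOn_gradient_le [CompleteSpace E] {K : Set E} {τ : ℝ} {g : E → ℝ}
    (hg : StrongConvexOn K τ g) {z w : E} (hz : z ∈ K) (hw : w ∈ K)
    (hd : DifferentiableAt ℝ g z) :
    g z + inner ℝ (gradient g z) (w - z) + τ / 2 * ‖w - z‖ ^ 2 ≤ g w := by
  have h1 := tendsto_slope_gradient hd (w - z)
  have h2 : Tendsto (fun θ : ℝ => g w - g z - (1 - θ) * (τ / 2 * ‖w - z‖ ^ 2)) (𝓝[>] 0)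
      (𝓝 (g w - g z - (1 - 0) * (τ / 2 * ‖w - z‖ ^ 2))) := by
    refine Tendsto.mono_left ?_ nhdsWithin_le_nhds
    exact Continuous.tendsto (by fun_prop) 0
  have h3 := le_of_tendsto_of_tendsto h1 h2 (by
    filter_upwards [Ioo_mem_nhdsGT (zero_lt_one' ℝ)] with θ hθ
    have h := hg.2 hz hw (show 0 ≤ 1 - θ by linarith [hθ.2]) hθ.1.le (by ring)
    have e : (1 - θ) • z + θ • w = z + θ • (w - z) := by
      rw [sub_smul, smul_sub, one_smul]; abel
    rw [e] at h
    simp only [smul_eq_mul, norm_sub_rev z w] at h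
    rw [div_le_iff₀ hθ.1]
    linarith)
  linarith

/-- Gradients of strongly convex functions are strongly monotone. -/
theorem strongConvexOn_gradient_monotone [CompleteSpace E] {K : Set E} {τ : ℝ} {g : E → ℝ}
    (hg : StrongConvexOn K τ g) {z w : E} (hz : z ∈ K) (hw : w ∈ K)
    (hdz : DifferentiableAt ℝ g z) (hdw : DifferentiableAt ℝ g w) :
    τ * ‖w - z‖ ^ 2 ≤ inner ℝ (gradient g w - gradient g z) (w - z) := by
  have h1 := strongConvexOn_gradient_le hg hz hw hdz
  have h2 := strongConvexOn_gradient_le hg hw hz hdw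
  rw [norm_sub_rev z w, ← neg_sub w z, inner_neg_right] at h2
  rw [inner_sub_left]
  linarith

/-- First-order optimality for the sum of a differentiable, a linear and a convex function. -/
theorem variational_inequality_of_isMinOn [CompleteSpace E] {K : Set E} {g r : E → ℝ} {c x₀ z : E}
    (hz : z ∈ K) (hd : DifferentiableAt ℝ g z) (hr : ConvexOn ℝ K r)
    (hmin : IsMinOn (fun w => g w + inner ℝ c (w - x₀) + r w) K z) {w : E} (hw : w ∈ K) :
    0 ≤ inner ℝ (gradient g z + c) (w - z) + r w - r z := by
  have h1 := (tendsto_slope_gradient hd (w - z)).add_const (inner ℝ c (w - z) + r w - r z)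
  have h2 := ge_of_tendsto (b := (0 : ℝ)) h1 (by
    filter_upwards [Ioo_mem_nhdsGT (zero_lt_one' ℝ)] with θ hθ
    have e : (1 - θ) • z + θ • w = z + θ • (w - z) := by
      rw [sub_smul, smul_sub, one_smul]; abel
    have hmem : z + θ • (w - z) ∈ K := by
      rw [← e]; exact hr.1 hz hw (by linarith [hθ.2]) hθ.1.le (by ring)
    have h := isMinOn_iff.1 hmin _ hmem
    have hrc := hr.2 hz hw (show 0 ≤ 1 - θ by linarith [hθ.2]) hθ.1.le (by ring)
    rw [e] at hrc
    simp only [smul_eq_mul] at hrc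
    have e2 : z + θ • (w - z) - x₀ = (z - x₀) + θ • (w - z) := by abel
    rw [e2, inner_add_right, inner_smul_right] at h
    have h3 : 0 ≤ (g (z + θ • (w - z)) - g z) + θ * (inner ℝ c (w - z) + r w - r z) := by
      linarith
    have h4 := div_nonneg h3 hθ.1.le
    rwa [add_div, mul_div_cancel_left₀ _ hθ.1.ne'] at h4)
  rw [inner_add_left]
  linarith

/-- A continuous function with a quadratic lower growth bound attains its minimum on closed
sets. -/
theorem exists_isMinOn_of_quadratic_growth [FiniteDimensional ℝ E] {K : Set E} (hK : IsClosed K)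
    {h : E → ℝ} (hc : ContinuousOn h K) {z₀ : E} (hz₀ : z₀ ∈ K) {τ C : ℝ} (hτ : 0 < τ)
    (hgrow : ∀ w ∈ K, h z₀ - C * ‖w - z₀‖ + τ * ‖w - z₀‖ ^ 2 ≤ h w) :
    ∃ z ∈ K, IsMinOn h K z := by
  have : ProperSpace E := FiniteDimensional.proper ℝ E
  refine hc.exists_isMinOn' hK hz₀ ?_
  rw [Filter.eventually_inf_principal]
  have hb : Bornology.IsBounded (Metric.closedBall z₀ (C / τ)) := Metric.isBounded_closedBall
  have := hb.isCompact_closure.compl_mem_cocompact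
  filter_upwards [this] with w hw hwK
  have hw' : C / τ < ‖w - z₀‖ := by
    rw [← dist_eq_norm]
    by_contra hcon
    exact hw (subset_closure (Metric.mem_closedBall.2 (not_lt.1 hcon)))
  rw [div_lt_iff₀ hτ] at hw'
  have := hgrow w hwK
  nlinarith [norm_nonneg (w - z₀)]

/-- First-order expansion with quadratic error for functions with Lipschitz gradient. -/
theorem abs_sub_gradient_le [CompleteSpace E] {K O : Set E} (hO : IsOpen O) (hKO : K ⊆ O)
    (hK : Convex ℝ K) {f : E → ℝ} (hf : ContDiffOn ℝ 1 f O) {L : ℝ≥0}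
    (hL : LipschitzOnWith L (gradient f) K) {x y : E} (hx : x ∈ K) (hy : y ∈ K) :
    |f y - f x - inner ℝ (gradient f x) (y - x)| ≤ L * ‖y - x‖ ^ 2 := by
  have hseg : segment ℝ x y ⊆ K := hK.segment_subset hx hy
  have hdiff : ∀ z ∈ K, DifferentiableAt ℝ f z := fun z hz =>
    (hf.differentiableOn (by norm_num)).differentiableAt (hO.mem_nhds (hKO hz))
  -- Working on the segment bounds the deviation of the gradient by L‖y - x‖. The mean value
  -- inequality then gives the constant L instead of L / 2, which is enough here.
  have h := Convex.norm_image_sub_le_of_norm_hasFDerivWithin_le'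
    (f := f) (f' := fun z => InnerProductSpace.toDual ℝ E (gradient f z)) (s := segment ℝ x y)
    (φ := InnerProductSpace.toDual ℝ E (gradient f x)) (C := L * ‖y - x‖)
    (fun z hz => (hdiff z (hseg hz)).hasGradientAt.hasFDerivAt.hasFDerivWithinAt)
    (fun z hz => by
      rw [← map_sub, LinearIsometryEquiv.norm_map]
      refine (hL.norm_sub_le (hseg hz) hx).trans (mul_le_mul_of_nonneg_left ?_ L.2)
      obtain ⟨a, b, ha, hb, hab, rfl⟩ := hz
      have : a • x + b • y - x = b • (y - x) := by
        rw [show a = 1 - b by linarith, sub_smul, one_smul, smul_sub]; abel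
      rw [this, norm_smul, Real.norm_of_nonneg hb]
      exact mul_le_of_le_one_left (norm_nonneg _) (by linarith))
    (convex_segment x y) (left_mem_segment ℝ x y) (right_mem_segment ℝ x y)
  rw [InnerProductSpace.toDual_apply_apply, Real.norm_eq_abs] at h
  calc _ ≤ _ := h
    _ = _ := by ring

/-- Sum rule for subdifferentials: if `s` minimizes the linear function `v` plus `r` over the convex
set `K`, where `r` is convex on `K` and has uniformly bounded global subgradients at the points of
`K`, then the first-order condition holds with a global subgradient of `r` at `s`. -/
theorem exists_global_subgradient [CompleteSpace E] {K : Set E} {r : E → ℝ} (hr : ConvexOn ℝ K r)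
    {C : ℝ} (hsub : ∀ x ∈ K, ∃ g : E, (∀ z, r x + inner ℝ g (z - x) ≤ r z) ∧ ‖g‖ ≤ C)
    {v s : E} (hs : s ∈ K) (hmin : ∀ w ∈ K, 0 ≤ inner ℝ v (w - s) + r w - r s) :
    ∃ ξ : E, (∀ z, r s + inner ℝ ξ (z - s) ≤ r z) ∧ ∀ w ∈ K, 0 ≤ inner ℝ (v + ξ) (w - s) := by
  choose! g hg hgC using hsub
  -- `r` need not be convex off `K`, so its own epigraph cannot be separated. `A` is the strict
  -- epigraph of the supremum of the affine minorants attached to points of `K`. That supremum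
  -- equals `r` on `K`, lies below `r` everywhere and is Lipschitz by the bound `C`; the uniform gap
  -- ε makes `A` open. `D` lies under the concave function that `hmin` places below `r` on `K`.
  let A : Set (E × ℝ) :=
    {p | ∃ ε > 0, ∀ u ∈ K, r u + inner ℝ (g u) (p.1 - u) + ε ≤ p.2}
  let D : Set (E × ℝ) := {p | p.1 ∈ K ∧ p.2 ≤ r s - inner ℝ v (p.1 - s)}
  have hC : 0 ≤ C := (norm_nonneg _).trans (hgC s hs)
  have hAc : Convex ℝ A := by
    rintro p ⟨ε, hε, hp⟩ q ⟨δ, hδ, hq⟩ a b ha hb hab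
    refine ⟨a * ε + b * δ, ?_, fun u hu => ?_⟩
    · rcases ha.eq_or_lt with rfl | ha'
      · have : b = 1 := by linarith
        subst this; simpa using hδ
      · exact add_pos_of_pos_of_nonneg (mul_pos ha' hε) (mul_nonneg hb hδ.le)
    · have h1 := mul_le_mul_of_nonneg_left (hp u hu) ha
      have h2 := mul_le_mul_of_nonneg_left (hq u hu) hb
      have e : (a • p + b • q).1 - u = a • (p.1 - u) + b • (q.1 - u) := by
        have : u = a • u + b • u := by rw [← add_smul, hab, one_smul]
        conv_lhs => rw [this]
        simp only [Prod.fst_add, Prod.smul_fst, smul_sub]; abel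
      rw [e, inner_add_right, inner_smul_right, inner_smul_right]
      simp only [Prod.snd_add, Prod.smul_snd, smul_eq_mul]
      have e2 : r u = a * r u + b * r u := by rw [← add_mul, hab, one_mul]
      linarith
  have hAo : IsOpen A := by
    rw [Metric.isOpen_iff]
    rintro p ⟨ε, hε, hp⟩
    have hC1 : 0 < 2 * (C + 1) := by linarith
    refine ⟨ε / (2 * (C + 1)), by positivity, fun q hq => ⟨ε / 2, by positivity, fun u hu => ?_⟩⟩
    rw [Metric.mem_ball, Prod.dist_eq, max_lt_iff, dist_eq_norm, Real.dist_eq,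
      lt_div_iff₀ hC1, lt_div_iff₀ hC1] at hq
    have h1 := hp u hu
    have h2 : inner ℝ (g u) (q.1 - p.1) ≤ C * ‖q.1 - p.1‖ :=
      (real_inner_le_norm _ _).trans (mul_le_mul_of_nonneg_right (hgC u hu) (norm_nonneg _))
    have e : q.1 - u = (p.1 - u) + (q.1 - p.1) := by abel
    rw [e, inner_add_right]
    have h3 := abs_lt.1 (show |q.2 - p.2| < ε / (2 * (C + 1)) by
      rw [lt_div_iff₀ hC1]; exact hq.2)
    have h4 : ‖q.1 - p.1‖ < ε / (2 * (C + 1)) := by rw [lt_div_iff₀ hC1]; exact hq.1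
    have h5 : C * (ε / (2 * (C + 1))) + ε / (2 * (C + 1)) = ε / 2 := by
      field_simp
    have h6 := mul_le_mul_of_nonneg_left h4.le hC
    linarith [h3.1]
  have hDc : Convex ℝ D := by
    rintro p ⟨hp, hp2⟩ q ⟨hq, hq2⟩ a b ha hb hab
    refine ⟨hr.1 hp hq ha hb hab, ?_⟩
    have h1 := mul_le_mul_of_nonneg_left hp2 ha
    have h2 := mul_le_mul_of_nonneg_left hq2 hb
    have e : (a • p + b • q).1 - s = a • (p.1 - s) + b • (q.1 - s) := by
      have : s = a • s + b • s := by rw [← add_smul, hab, one_smul]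
      conv_lhs => rw [this]
      simp only [Prod.fst_add, Prod.smul_fst, smul_sub]; abel
    rw [e, inner_add_right, inner_smul_right, inner_smul_right]
    simp only [Prod.snd_add, Prod.smul_snd, smul_eq_mul]
    have e2 : r s = a * r s + b * r s := by rw [← add_mul, hab, one_mul]
    linarith
  have hdisj : Disjoint A D := by
    rw [Set.disjoint_left]
    rintro p ⟨ε, hε, hp⟩ ⟨hpK, hp2⟩
    have h1 := hp _ hpK
    have h2 := hmin _ hpK
    simp only [sub_self, inner_zero_right] at h1
    linarith
  obtain ⟨F, c, hFA, hFD⟩ := geometric_hahn_banach_open hAc hAo hDc hdisj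
  set p : E := (InnerProductSpace.toDual ℝ E).symm (F.comp (ContinuousLinearMap.inl ℝ E ℝ))
  set β : ℝ := F (0, 1)
  have hF : ∀ z τ, F (z, τ) = inner ℝ p z + τ * β := by
    intro z τ
    have e : ((z, τ) : E × ℝ) = (z, 0) + τ • (0, 1) := by simp
    rw [e, map_add, map_smul, InnerProductSpace.toDual_symm_apply]
    simp [β]
  have hmemA : ∀ z, ∀ ε > 0, (z, r z + ε) ∈ A := fun z ε hε =>
    ⟨ε, hε, fun u hu => by simpa using hg u hu z⟩
  have hmemD : ∀ w ∈ K, (w, r s - inner ℝ v (w - s)) ∈ D := fun w hw => ⟨hw, le_rfl⟩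
  have key : ∀ z, ∀ w ∈ K, ∀ ε > 0,
      inner ℝ p z + (r z + ε) * β < inner ℝ p w + (r s - inner ℝ v (w - s)) * β := by
    intro z w hw ε hε
    rw [← hF, ← hF]
    exact (hFA _ (hmemA z ε hε)).trans_le (hFD _ (hmemD w hw))
  -- The separating hyperplane is not vertical, because both sets contain points above s.
  have hβ : β < 0 := by
    have := key s s hs 1 one_pos
    simp only [sub_self, inner_zero_right] at this
    linarith
  have key' : ∀ z, ∀ w ∈ K,
      inner ℝ p z + r z * β ≤ inner ℝ p w + (r s - inner ℝ v (w - s)) * β := by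
    intro z w hw
    refine le_of_forall_pos_le_add fun δ hδ => ?_
    have := key z w hw (δ / -β) (div_pos hδ (by linarith))
    have e : δ / -β * β = -δ := by rw [div_neg, neg_mul, div_mul_cancel₀ _ hβ.ne]
    rw [add_mul, e] at this
    linarith
  -- In `key'`, setting w = s gives the global subgradient inequality and setting z = s gives the
  -- variational inequality.
  refine ⟨(-β)⁻¹ • p, fun z => ?_, fun w hw => ?_⟩
  · have := key' z s hs
    simp only [sub_self, inner_zero_right] at this
    rw [real_inner_smul_left, inner_sub_right, inv_mul_eq_div]
    have h2 : (inner ℝ p z - inner ℝ p s) / -β ≤ r z - r s := by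
      rw [div_le_iff₀ (by linarith)]; linarith
    linarith
  · have := key' s w hw
    rw [inner_add_left, real_inner_smul_left, inner_sub_right p, inv_mul_eq_div]
    have h2 : -(inner ℝ v (w - s)) ≤ (inner ℝ p w - inner ℝ p s) / -β := by
      rw [le_div_iff₀ (by linarith)]; linarith
    linarith

end ConvexAnalysis

/-! ### Existence, stability and descent of strongly convex responses. -/

section BestResponse

variable {E : Type*} [NormedAddCommGroup E] [InnerProductSpace ℝ E] [CompleteSpace E]

/-- `z` solves the variational inequality of minimizing `g + ⟨c, ·⟩ + r` over `K`. -/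
def IsResponse (K : Set E) (g r : E → ℝ) (c z : E) : Prop :=
  z ∈ K ∧ ∀ w ∈ K, 0 ≤ inner ℝ (gradient g z + c) (w - z) + r w - r z

/-- Testing each variational inequality at the other solution and adding cancels `r`; strong
monotonicity of the gradient of `g₁` then absorbs the distance. Only the mismatch at `z₂` matters.
-/
theorem IsResponse.norm_sub_le {K : Set E} {g₁ g₂ r : E → ℝ} {c₁ c₂ z₁ z₂ : E} {τ δ : ℝ}
    (hτ : 0 < τ) (hg : StrongConvexOn K τ g₁) (hd : ∀ z ∈ K, DifferentiableAt ℝ g₁ z)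
    (h₁ : IsResponse K g₁ r c₁ z₁) (h₂ : IsResponse K g₂ r c₂ z₂)
    (hδ : ‖(gradient g₂ z₂ + c₂) - (gradient g₁ z₂ + c₁)‖ ≤ δ) : ‖z₁ - z₂‖ ≤ δ / τ := by
  have hm := strongConvexOn_gradient_monotone hg h₂.1 h₁.1 (hd _ h₂.1) (hd _ h₁.1)
  have e1 := h₁.2 _ h₂.1
  have e2 := h₂.2 _ h₁.1
  have hle : inner ℝ ((gradient g₂ z₂ + c₂) - (gradient g₁ z₂ + c₁)) (z₁ - z₂)
      ≤ δ * ‖z₁ - z₂‖ :=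
    (real_inner_le_norm _ _).trans (mul_le_mul_of_nonneg_right hδ (norm_nonneg _))
  rw [← neg_sub z₁ z₂, inner_neg_right] at e1
  simp only [inner_sub_left, inner_add_left] at hm e1 e2 hle
  have h : τ * ‖z₁ - z₂‖ ^ 2 ≤ δ * ‖z₁ - z₂‖ := by linarith
  rw [le_div_iff₀ hτ]
  rcases (norm_nonneg (z₁ - z₂)).eq_or_lt with h0 | h0
  · rw [← h0, zero_mul]; exact (norm_nonneg _).trans hδ
  · nlinarith

/-- Descent property of the response. -/
theorem IsResponse.descent {K : Set E} {g r : E → ℝ} {v x z : E} {τ : ℝ}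
    (hg : StrongConvexOn K τ g) (hd : ∀ z ∈ K, DifferentiableAt ℝ g z) (hx : x ∈ K)
    (h : IsResponse K g r (v - gradient g x) z) :
    inner ℝ v (z - x) + r z - r x ≤ -(τ * ‖z - x‖ ^ 2) := by
  have hm := strongConvexOn_gradient_monotone hg hx h.1 (hd _ hx) (hd _ h.1)
  have e1 := h.2 _ hx
  rw [← neg_sub z x, inner_neg_right] at e1
  simp only [inner_sub_left, inner_add_left] at hm e1 ⊢
  linarith

/-- The descent inequality is quadratic in the displacement, while the linear term and the
subgradient cost only linear terms. This is what bounds the algorithm's directions. -/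
theorem IsResponse.norm_sub_le_of_subgradient {K : Set E} {g r : E → ℝ} {v x z ξ : E} {τ : ℝ}
    (hτ : 0 < τ) (hg : StrongConvexOn K τ g) (hd : ∀ z ∈ K, DifferentiableAt ℝ g z) (hx : x ∈ K)
    (h : IsResponse K g r (v - gradient g x) z) (hξ : r x + inner ℝ ξ (z - x) ≤ r z) :
    ‖z - x‖ ≤ (‖v‖ + ‖ξ‖) / τ := by
  have h1 := h.descent hg hd hx
  have h2 := neg_le_of_abs_le (abs_real_inner_le_norm v (z - x))
  have h3 := neg_le_of_abs_le (abs_real_inner_le_norm ξ (z - x))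
  rw [le_div_iff₀ hτ]
  rcases (norm_nonneg (z - x)).eq_or_lt with h0 | h0
  · rw [← h0, zero_mul]; positivity
  · nlinarith

/-- Needed because exact responses are evaluated at points the algorithm never visits. Bounded
subgradients make `r` Lipschitz on `K` with at most linear decrease, which the quadratic growth of
`g` dominates. -/
theorem exists_isResponse [FiniteDimensional ℝ E] {K : Set E} (hK : IsClosed K)
    (hne : K.Nonempty) {g r : E → ℝ} {τ C : ℝ} (hτ : 0 < τ) (hg : StrongConvexOn K τ g)
    (hd : ∀ z ∈ K, DifferentiableAt ℝ g z) (hr : ConvexOn ℝ K r)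
    (hsub : ∀ x ∈ K, ∃ ξ : E, (∀ z, r x + inner ℝ ξ (z - x) ≤ r z) ∧ ‖ξ‖ ≤ C) (c : E) :
    ∃ z, IsResponse K g r c z := by
  obtain ⟨z₀, hz₀⟩ := hne
  have hlow : ∀ x ∈ K, ∀ y, r x - C * ‖y - x‖ ≤ r y := by
    intro x hx y
    obtain ⟨ξ, h1, h2⟩ := hsub x hx
    have := neg_le_of_abs_le (abs_real_inner_le_norm ξ (y - x))
    have := mul_le_mul_of_nonneg_right h2 (norm_nonneg (y - x))
    linarith [h1 y]
  have hC : 0 ≤ C := by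
    obtain ⟨ξ, -, h2⟩ := hsub z₀ hz₀
    exact (norm_nonneg _).trans h2
  have hrc : ContinuousOn r K := by
    refine (LipschitzOnWith.of_dist_le_mul (K := NNReal.mk C hC) fun x hx y hy => ?_).continuousOn
    rw [Real.dist_eq, dist_eq_norm, NNReal.coe_mk, abs_le]
    have h1 := hlow x hx y
    have h2 := hlow y hy x
    rw [norm_sub_rev y x] at h1
    constructor <;> linarith
  have hcont : ContinuousOn (fun w => g w + inner ℝ c (w - 0) + r w) K := by
    refine (ContinuousOn.add (fun z hz => (hd z hz).continuousAt.continuousWithinAt) ?_).add hrc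
    fun_prop
  obtain ⟨z, hz, hmin⟩ := exists_isMinOn_of_quadratic_growth hK hcont hz₀ (half_pos hτ)
    (C := ‖gradient g z₀‖ + ‖c‖ + C) fun w hw => by
      have h1 := strongConvexOn_gradient_le hg hz₀ hw (hd _ hz₀)
      have h2 := hlow z₀ hz₀ w
      have h3 := neg_le_of_abs_le (abs_real_inner_le_norm (gradient g z₀) (w - z₀))
      have h4 := neg_le_of_abs_le (abs_real_inner_le_norm c (w - z₀))
      simp only [sub_zero]
      rw [inner_sub_right] at h4
      linarith
  exact ⟨z, hz, fun w hw => variational_inequality_of_isMinOn hz (hd z hz) hr hmin hw⟩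

end BestResponse

/-- Merges finitely many constants into one; the added 1 gives positivity even for an empty index
type. Lower bounds are merged by applying it to inverses. -/
theorem exists_uniform_bound {ι : Type*} [Fintype ι] {P : ι → ℝ → Prop}
    (hmono : ∀ i C D, C ≤ D → P i C → P i D) (h : ∀ i, ∃ C, P i C) :
    ∃ C, 0 < C ∧ ∀ i, P i C := by
  choose C hC using h
  refine ⟨∑ i, |C i| + 1, by positivity, fun i => hmono i _ _ ?_ (hC i)⟩
  have := Finset.single_le_sum (f := fun i => |C i|) (fun _ _ => abs_nonneg _) (Finset.mem_univ i)
  linarith [le_abs_self (C i)]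

/-! ### Block vectors and the product feasible set. -/

section BlockVectors

variable {B d : ℕ}

theorem norm_le_sum_norm (x : BlockVec B d) : ‖x‖ ≤ ∑ l, ‖x l‖ := by
  rw [PiLp.norm_eq_of_L2]
  refine Real.sqrt_le_iff.2 ⟨Finset.sum_nonneg fun _ _ => norm_nonneg _, ?_⟩
  exact Finset.sum_sq_le_sq_sum_of_nonneg fun _ _ => norm_nonneg _

theorem norm_block_sub_le (x y : BlockVec B d) (l : Fin B) : ‖x l - y l‖ ≤ ‖x - y‖ :=
  PiLp.norm_apply_le (x - y) l

theorem blockVec_sum_apply {ι : Type*} (s : Finset ι) (x : ι → BlockVec B d) (l : Fin B) :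
    (∑ i ∈ s, x i) l = ∑ i ∈ s, x i l := by
  simp

variable {K : Fin B → Set (Block d)}

theorem isClosed_feasibleSet (hK : ∀ l, IsClosed (K l)) : IsClosed (feasibleSet K) := by
  have : feasibleSet K = ⋂ l, (fun x : BlockVec B d => x l) ⁻¹' K l := by
    ext x; simp [feasibleSet]
  rw [this]
  exact isClosed_iInter fun l => (hK l).preimage (by fun_prop)

theorem convex_feasibleSet (hK : ∀ l, Convex ℝ (K l)) : Convex ℝ (feasibleSet K) :=
  fun _ hx _ hy _ _ ha hb hab l => hK l (hx l) (hy l) ha hb hab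

end BlockVectors

/-! ### Uniform constants, block responses and the objective. -/

section Problem

variable {N B d : ℕ} {f : Fin N → BlockVec B d → ℝ} {r : Fin B → Block d → ℝ}
  {K : Fin B → Set (Block d)} {ft : Fin N → Fin B → Block d → BlockVec B d → ℝ}

theorem ProblemAssumptions.exists_lipschitz (h : ProblemAssumptions f r K) :
    ∃ L : ℝ, 0 < L ∧ ∀ i, ∀ x ∈ feasibleSet K, ∀ y ∈ feasibleSet K,
      ‖gradient (f i) y - gradient (f i) x‖ ≤ L * ‖y - x‖ ∧
      |f i y - f i x - inner ℝ (gradient (f i) x) (y - x)| ≤ L * ‖y - x‖ ^ 2 := by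
  refine exists_uniform_bound (P := fun i L => ∀ x ∈ feasibleSet K, ∀ y ∈ feasibleSet K,
      ‖gradient (f i) y - gradient (f i) x‖ ≤ L * ‖y - x‖ ∧
      |f i y - f i x - inner ℝ (gradient (f i) x) (y - x)| ≤ L * ‖y - x‖ ^ 2) ?_ fun i => ?_
  · intro i C D hCD hC x hx y hy
    exact ⟨(hC x hx y hy).1.trans (by gcongr), (hC x hx y hy).2.trans (by gcongr)⟩
  · obtain ⟨O, hO, hKO, hf⟩ := h.smooth i
    obtain ⟨L, hL⟩ := h.grad_lipschitz i
    exact ⟨L, fun x hx y hy => ⟨hL.norm_sub_le hy hx,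
      abs_sub_gradient_le hO hKO (convex_feasibleSet h.convex) hf hL hx hy⟩⟩

theorem ProblemAssumptions.exists_gradient_bound (h : ProblemAssumptions f r K) :
    ∃ C : ℝ, 0 < C ∧ ∀ i, ∀ x ∈ feasibleSet K, ‖gradient (f i) x‖ ≤ C :=
  exists_uniform_bound (P := fun i C => ∀ x ∈ feasibleSet K, ‖gradient (f i) x‖ ≤ C)
    (fun _ _ _ hCD hC x hx => (hC x hx).trans hCD) h.grad_bounded

theorem ProblemAssumptions.exists_subgradient_bound (h : ProblemAssumptions f r K) :
    ∃ C : ℝ, 0 < C ∧ ∀ l, ∀ x ∈ K l, ∃ g, IsSubgradient (r l) x g ∧ ‖g‖ ≤ C :=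
  exists_uniform_bound (P := fun l C => ∀ x ∈ K l, ∃ g, IsSubgradient (r l) x g ∧ ‖g‖ ≤ C)
    (fun _ _ _ hCD hC x hx => let ⟨g, h1, h2⟩ := hC x hx; ⟨g, h1, h2.trans hCD⟩)
    h.reg_subgradient

theorem SurrogateAssumptions.exists_modulus (h : SurrogateAssumptions f K ft) :
    ∃ τ : ℝ, 0 < τ ∧ ∀ i l, ∀ x ∈ feasibleSet K, StrongConvexOn (K l) τ (fun w => ft i l w x) := by
  obtain ⟨C, hC, h⟩ := exists_uniform_bound (P := fun i C => ∃ τ, 0 < τ ∧ τ⁻¹ ≤ C ∧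
    ∀ l, ∀ x ∈ feasibleSet K, StrongConvexOn (K l) τ (fun w => ft i l w x))
    (fun _ _ _ hCD ⟨τ, h1, h2, h3⟩ => ⟨τ, h1, h2.trans hCD, h3⟩)
    (fun i => let ⟨τ, h1, h2⟩ := h.strongly_convex i; ⟨τ⁻¹, τ, h1, le_rfl, h2⟩)
  refine ⟨C⁻¹, inv_pos.2 hC, fun i l x hx => ?_⟩
  obtain ⟨τ, h1, h2, h3⟩ := h i
  exact (h3 l x hx).mono (inv_le_of_inv_le₀ h1 h2)

theorem SurrogateAssumptions.exists_lipschitz (h : SurrogateAssumptions f K ft) :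
    ∃ L : ℝ, 0 < L ∧ ∀ i l, ∀ z ∈ K l, ∀ x ∈ feasibleSet K, ∀ y ∈ feasibleSet K,
      ‖gradient (fun w => ft i l w y) z - gradient (fun w => ft i l w x) z‖ ≤ L * ‖y - x‖ := by
  obtain ⟨L, hL, h⟩ := exists_uniform_bound (ι := Fin N × Fin B)
    (P := fun p L => ∀ z ∈ K p.2, ∀ x ∈ feasibleSet K, ∀ y ∈ feasibleSet K,
      ‖gradient (fun w => ft p.1 p.2 w y) z - gradient (fun w => ft p.1 p.2 w x) z‖
        ≤ L * ‖y - x‖)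
    (fun _ _ _ hCD hC z hz x hx y hy => (hC z hz x hx y hy).trans (by gcongr))
    (fun p => let ⟨L, hL⟩ := h.grad_lipschitz p.1 p.2
      ⟨L, fun z hz x hx y hy => (hL z hz).norm_sub_le hy hx⟩)
  exact ⟨L, hL, fun i l => h (i, l)⟩

/-- `z` is the response of agent `i` on block `l` at the point `x` when the gradient of the sum is
estimated by `v`. -/
def IsBlockResponse (f : Fin N → BlockVec B d → ℝ) (r : Fin B → Block d → ℝ)
    (K : Fin B → Set (Block d)) (ft : Fin N → Fin B → Block d → BlockVec B d → ℝ)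
    (i : Fin N) (l : Fin B) (x : BlockVec B d) (v z : Block d) : Prop :=
  IsResponse (K l) (fun w => ft i l w x) (r l) (v - gradient (f i) x l) z

/-- The two optimality maps are compared at the same first argument `z'`, so only the Lipschitz
dependence of the surrogate gradient on its base point is needed. -/
theorem exists_response_lipschitz (hp : ProblemAssumptions f r K)
    (hs : SurrogateAssumptions f K ft) :
    ∃ C : ℝ, 0 < C ∧ ∀ i l, ∀ x ∈ feasibleSet K, ∀ y ∈ feasibleSet K, ∀ v w z z',
      IsBlockResponse f r K ft i l x v z → IsBlockResponse f r K ft i l y w z' →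
      ‖z - z'‖ ≤ C * (‖y - x‖ + ‖w - v‖) := by
  obtain ⟨L, hL, hLip⟩ := hp.exists_lipschitz
  obtain ⟨M, hM, hMLip⟩ := hs.exists_lipschitz
  obtain ⟨τ, hτ, hconv⟩ := hs.exists_modulus
  refine ⟨(L + M + 1) / τ, by positivity, fun i l x hx y hy v w z z' hz hz' => ?_⟩
  have hδ : ‖(gradient (fun u => ft i l u y) z' + (w - gradient (f i) y l))
      - (gradient (fun u => ft i l u x) z' + (v - gradient (f i) x l))‖
      ≤ M * ‖y - x‖ + ‖w - v‖ + L * ‖y - x‖ := by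
    have e : (gradient (fun u => ft i l u y) z' + (w - gradient (f i) y l))
        - (gradient (fun u => ft i l u x) z' + (v - gradient (f i) x l))
        = (gradient (fun u => ft i l u y) z' - gradient (fun u => ft i l u x) z') + (w - v)
          - (gradient (f i) y l - gradient (f i) x l) := by abel
    rw [e]
    refine norm_sub_le_of_le (norm_add_le_of_le (hMLip i l z' hz'.1 x hx y hy) le_rfl)
      ((norm_block_sub_le _ _ l).trans (hLip i x hx y hy).1)
  refine (hz.norm_sub_le hτ (hconv i l x hx) (hs.differentiable i l x hx) hz' hδ).trans ?_
  rw [div_mul_eq_mul_div]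
  refine div_le_div_of_nonneg_right ?_ hτ.le
  nlinarith [norm_nonneg (y - x), norm_nonneg (w - v), mul_nonneg hL.le (norm_nonneg (w - v)),
    mul_nonneg hM.le (norm_nonneg (w - v))]

/-- Gradient consistency identifies the subtracted block gradient with the surrogate's gradient at
`x l`, so `v` alone survives as the linear model. -/
theorem IsBlockResponse.descent (hs : SurrogateAssumptions f K ft) {τ : ℝ}
    (hconv : ∀ i l, ∀ x ∈ feasibleSet K, StrongConvexOn (K l) τ (fun w => ft i l w x))
    {i : Fin N} {l : Fin B} {x : BlockVec B d} {v z : Block d} (hx : x ∈ feasibleSet K)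
    (hz : IsBlockResponse f r K ft i l x v z) :
    inner ℝ v (z - x l) + r l z - r l (x l) ≤ -(τ * ‖z - x l‖ ^ 2) := by
  rw [IsBlockResponse, ← hs.grad_consistent i l x hx] at hz
  exact IsResponse.descent (hconv i l x hx) (hs.differentiable i l x hx) (hx l) hz

theorem exists_response_bound (hp : ProblemAssumptions f r K) (hs : SurrogateAssumptions f K ft) :
    ∃ C : ℝ, 0 < C ∧ ∀ i l, ∀ x ∈ feasibleSet K, ∀ v z, IsBlockResponse f r K ft i l x v z →
      ‖z - x l‖ ≤ C * (‖v‖ + C) := by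
  obtain ⟨A, hA, hsub⟩ := hp.exists_subgradient_bound
  obtain ⟨τ, hτ, hconv⟩ := hs.exists_modulus
  refine ⟨A + τ⁻¹, by positivity, fun i l x hx v z hz => ?_⟩
  rw [IsBlockResponse, ← hs.grad_consistent i l x hx] at hz
  obtain ⟨ξ, h1, h2⟩ := hsub l _ (hx l)
  have h3 := hz.norm_sub_le_of_subgradient hτ (hconv i l x hx) (hs.differentiable i l x hx) (hx l)
    (h1 z)
  rw [div_eq_inv_mul] at h3
  have hτi : 0 < τ⁻¹ := inv_pos.2 hτ
  exact h3.trans (mul_le_mul (by linarith) (by linarith) (by positivity) (by positivity))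

theorem exists_isBlockResponse (hp : ProblemAssumptions f r K) (hs : SurrogateAssumptions f K ft)
    (i : Fin N) (l : Fin B) {x : BlockVec B d} (hx : x ∈ feasibleSet K) (v : Block d) :
    ∃ z, IsBlockResponse f r K ft i l x v z := by
  obtain ⟨A, -, hsub⟩ := hp.exists_subgradient_bound
  obtain ⟨τ, hτ, hconv⟩ := hs.exists_modulus
  exact exists_isResponse (hp.closed l) (hp.nonempty l) hτ (hconv i l x hx)
    (hs.differentiable i l x hx) (hp.reg_convex l) (hsub l) _

/-- A feasible point all of whose exact block responses are its own blocks is stationary. -/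
theorem isStationary_of_response (hp : ProblemAssumptions f r K)
    (hs : SurrogateAssumptions f K ft) (i : Fin N) {s : BlockVec B d} (hsK : s ∈ feasibleSet K)
    (h : ∀ l, IsBlockResponse f r K ft i l s ((∑ j, gradient (f j) s) l) (s l)) :
    IsStationary f r K s := by
  -- At a fixed point of the response, the surrogate gradient cancels the agent's own block
  -- gradient, leaving the gradient of the whole sum.
  have hvi : ∀ l, ∀ w ∈ K l,
      0 ≤ inner ℝ ((∑ j, gradient (f j) s) l) (w - s l) + r l w - r l (s l) := by
    intro l w hw
    have h1 := (h l).2 w hw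
    rwa [hs.grad_consistent i l s hsK, add_sub_cancel] at h1
  have hξ : ∀ l, ∃ ξ : Block d, IsSubgradient (r l) (s l) ξ ∧
      ∀ w ∈ K l, 0 ≤ inner ℝ ((∑ j, gradient (f j) s) l + ξ) (w - s l) := fun l =>
    let ⟨_, hC⟩ := hp.reg_subgradient l
    exists_global_subgradient (hp.reg_convex l) hC (hsK l) (hvi l)
  choose ξ h1 h2 using hξ
  refine ⟨hsK, WithLp.toLp 2 ξ, h1, fun z hz => ?_⟩
  rw [PiLp.inner_apply]
  exact Finset.sum_nonneg fun l _ => h2 l _ (hz l)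

theorem ProblemAssumptions.isBounded_sublevel (h : ProblemAssumptions f r K) (M : ℝ) :
    Bornology.IsBounded {x | x ∈ feasibleSet K ∧ objective f r x ≤ M} := by
  have h1 := h.coercive.eventually_gt_atTop M
  rw [Filter.eventually_inf_principal] at h1
  rw [← Bornology.isCobounded_compl_iff]
  refine Filter.mem_of_superset h1 fun x hx hx' => ?_
  exact not_le.2 (hx hx'.1) hx'.2

/-- Coercivity confines the points of nonpositive value to a ball; there the expansions of `f` and
the subgradients of `r` at one feasible point bound the objective from below. -/
theorem ProblemAssumptions.exists_objective_lower_bound (h : ProblemAssumptions f r K) :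
    ∃ m : ℝ, ∀ x ∈ feasibleSet K, m ≤ objective f r x := by
  obtain ⟨L, hL, hLip⟩ := h.exists_lipschitz
  obtain ⟨G, hG, hgrad⟩ := h.exists_gradient_bound
  obtain ⟨C, hC, hsub⟩ := h.exists_subgradient_bound
  choose p hp using h.nonempty
  set x₀ : BlockVec B d := WithLp.toLp 2 p with hx₀
  have hx₀K : x₀ ∈ feasibleSet K := hp
  obtain ⟨R, hR⟩ := (h.isBounded_sublevel 0).subset_closedBall x₀
  refine ⟨min 0 (∑ i, (f i x₀ - G * R - L * R ^ 2) + ∑ l, (r l (x₀ l) - C * R)), fun x hx => ?_⟩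
  rcases le_or_gt (objective f r x) 0 with h0 | h0
  · refine (min_le_right _ _).trans ?_
    have hxR : ‖x - x₀‖ ≤ R := by
      rw [← dist_eq_norm]; exact Metric.mem_closedBall.1 (hR ⟨hx, h0⟩)
    refine add_le_add (Finset.sum_le_sum fun i _ => ?_) (Finset.sum_le_sum fun l _ => ?_)
    · have h1 := neg_le_of_abs_le (hLip i x₀ hx₀K x hx).2
      have h2 := neg_le_of_abs_le (abs_real_inner_le_norm (gradient (f i) x₀) (x - x₀))
      have h3 : ‖gradient (f i) x₀‖ * ‖x - x₀‖ ≤ G * R :=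
        mul_le_mul (hgrad i x₀ hx₀K) hxR (norm_nonneg _) hG.le
      have h4 : L * ‖x - x₀‖ ^ 2 ≤ L * R ^ 2 := by gcongr
      linarith
    · obtain ⟨g, h1, h2⟩ := hsub l _ (hx₀K l)
      have h3 := neg_le_of_abs_le (abs_real_inner_le_norm g (x l - x₀ l))
      have h4 : ‖g‖ * ‖x l - x₀ l‖ ≤ C * R :=
        mul_le_mul h2 ((norm_block_sub_le x x₀ l).trans hxR) (norm_nonneg _) hC.le
      linarith [h1 (x l)]
  · exact (min_le_left _ _).trans h0.le

end Problem

/-! ### Weights and active edges. -/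

section Network

variable {N B : ℕ} {G : Digraph (Fin N)} {sel : ℕ → Fin N → Fin B}
  {a : ℕ → Fin B → Matrix (Fin N) (Fin N) ℝ}

theorem WeightAssumptions.nonneg (h : WeightAssumptions G sel a) (t l i j) : 0 ≤ a t l i j := by
  obtain ⟨κ, hκ, hlow⟩ := h.lower_bound
  by_cases hadj : (blockGraph G sel t l).Adj j i
  · exact hκ.le.trans (hlow t l i j hadj).le
  · rw [h.zero t l i j hadj]

theorem WeightAssumptions.eq_zero (h : WeightAssumptions G sel a) {t l i j}
    (hj : j ∉ nbhd G sel t l i) : a t l i j = 0 :=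
  h.zero t l i j fun hadj => hj hadj.2

theorem blockGraph_adj_self (hG : NetworkAssumptions G) (t l i) :
    (blockGraph G sel t l).Adj i i :=
  ⟨hG.self_loop i, by simp [nbhd]⟩

theorem blockGraph_adj_of_sel {t l j i} (hadj : G.Adj j i) (hsel : sel t j = l) :
    (blockGraph G sel t l).Adj j i :=
  ⟨hadj, by simp [nbhd, hadj, hsel]⟩

theorem EssentiallyCyclic.exists_active (hsel : EssentiallyCyclic sel) (l : Fin B) (j i : Fin N)
    (hadj : G.Adj j i) : ∃ T, ∀ t, ∃ s < T, (blockGraph G sel (t + s) l).Adj j i := by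
  obtain ⟨T, -, hT⟩ := hsel j
  refine ⟨T, fun t => ?_⟩
  obtain ⟨s, hs, h⟩ := hT t l
  exact ⟨s, hs, blockGraph_adj_of_sel hadj h⟩

/-- The row-stochastic weights `a_{ijl}^t φ_{(j,l)}^t / φ_{(i,l)}^{t+1}`. -/
noncomputable def mixing (a : ℕ → Fin B → Matrix (Fin N) (Fin N) ℝ) (φ : ℕ → Fin N → Fin B → ℝ)
    (l : Fin B) (t : ℕ) : Matrix (Fin N) (Fin N) ℝ :=
  fun i j => a t l i j * φ t j l / φ (t + 1) i l

end Network

/-! ### Consensus and gradient tracking along a run. -/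

/-- The standing assumptions together with a run of the algorithm. -/
structure Run {N B d : ℕ} (f : Fin N → BlockVec B d → ℝ) (r : Fin B → Block d → ℝ)
    (K : Fin B → Set (Block d)) (G : Digraph (Fin N)) (sel : ℕ → Fin N → Fin B)
    (a : ℕ → Fin B → Matrix (Fin N) (Fin N) ℝ)
    (ft : Fin N → Fin B → Block d → BlockVec B d → ℝ) (γ : ℕ → ℝ)
    (φ : ℕ → Fin N → Fin B → ℝ) (x y : ℕ → Fin N → BlockVec B d)
    (xt : ℕ → Fin N → Block d) : Prop where
  agents : 0 < N
  problem : ProblemAssumptions f r K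
  network : NetworkAssumptions G
  weights : WeightAssumptions G sel a
  selection : EssentiallyCyclic sel
  surrogate : SurrogateAssumptions f K ft
  step : StepAssumptions γ
  generated : IsGenerated f r K G sel a ft γ φ x y xt

namespace Run

variable {N B d : ℕ} {f : Fin N → BlockVec B d → ℝ} {r : Fin B → Block d → ℝ}
  {K : Fin B → Set (Block d)} {G : Digraph (Fin N)} {sel : ℕ → Fin N → Fin B}
  {a : ℕ → Fin B → Matrix (Fin N) (Fin N) ℝ}
  {ft : Fin N → Fin B → Block d → BlockVec B d → ℝ} {γ : ℕ → ℝ}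
  {φ : ℕ → Fin N → Fin B → ℝ} {x y : ℕ → Fin N → BlockVec B d} {xt : ℕ → Fin N → Block d}

theorem phi_succ (h : Run f r K G sel a ft γ φ x y xt) (t i l) :
    φ (t + 1) i l = ∑ j, a t l i j * φ t j l := by
  rw [h.generated.step_phi]
  refine Finset.sum_subset (Finset.subset_univ _) fun j _ hj => ?_
  rw [h.weights.eq_zero hj, zero_mul]

theorem sum_phi (h : Run f r K G sel a ft γ φ x y xt) (t l) : ∑ i, φ t i l = N := by
  induction t with
  | zero => simp [h.generated.init_phi]
  | succ t ih =>
    simp only [h.phi_succ]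
    rw [Finset.sum_comm]
    simp only [← Finset.sum_mul, h.weights.column_stochastic, one_mul, ih]

theorem phi_transition (h : Run f r K G sel a ft γ φ x y xt) (t m i l) :
    φ (t + m) i l = ∑ j, transition (fun t => a t l) t m i j * φ t j l := by
  induction m generalizing i with
  | zero => simp [transition, Matrix.one_apply]
  | succ m ih =>
    rw [← add_assoc, h.phi_succ]
    simp only [ih, transition, Matrix.mul_apply, Finset.sum_mul, Finset.mul_sum]
    rw [Finset.sum_comm]
    simp only [mul_assoc]

/-- The total mass N is conserved, and over a window of length m every agent receives at least the
fraction κ ^ m of it. The first m steps are covered by the self-loops. -/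
theorem exists_phi_lower_bound (h : Run f r K G sel a ft γ φ x y xt) :
    ∃ c : ℝ, 0 < c ∧ ∀ t i l, c ≤ φ t i l := by
  obtain ⟨κ, hκ, hlow⟩ := h.weights.lower_bound
  have hdiag : ∀ t l i, κ ≤ a t l i i := fun t l i =>
    (hlow t l i i (blockGraph_adj_self h.network t l i)).le
  -- This bound decays with t; it serves the times before m and supplies positivity for the uniform
  -- bound.
  have hpos : ∀ t i l, κ ^ t ≤ φ t i l := by
    intro t i l
    have h1 := h.phi_transition 0 t i l
    simp only [zero_add, h.generated.init_phi, mul_one] at h1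
    rw [h1]
    exact (pow_le_transition_diag (W := fun t => a t l) (fun t => h.weights.nonneg t l) hκ.le
      (fun t => hdiag t l) 0 t i).trans
      (Finset.single_le_sum (f := fun j => transition (fun t => a t l) 0 t i j)
        (fun j _ => transition_nonneg (fun t => h.weights.nonneg t l) 0 t i j)
        (Finset.mem_univ i))
  have hN : (1 : ℝ) ≤ N := by exact_mod_cast h.agents
  have hl : ∀ l, ∃ c : ℝ, 0 < c ∧ ∀ t i, c ≤ φ t i l := by
    intro l
    have hκ1 : κ ≤ 1 := by
      rw [← h.weights.column_stochastic 0 l ⟨0, h.agents⟩]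
      exact (hdiag 0 l ⟨0, h.agents⟩).trans (Finset.single_le_sum
        (f := fun i => a 0 l i ⟨0, h.agents⟩) (fun i _ => h.weights.nonneg 0 l i _)
        (Finset.mem_univ _))
    obtain ⟨m, -, hm⟩ := exists_pow_le_transition (W := fun t => a t l)
      (fun t => h.weights.nonneg t l) hκ (fun t => hdiag t l) (R := G.Adj)
      (fun j i hadj => by
        obtain ⟨T, hT⟩ := h.selection.exists_active l j i hadj
        refine ⟨T, fun t => ?_⟩
        obtain ⟨s, hs, hs'⟩ := hT t
        exact ⟨s, hs, (hlow _ l i j hs').le⟩) h.network.strongly_connected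
    refine ⟨κ ^ m, by positivity, fun t i => ?_⟩
    rcases le_or_gt m t with hmt | hmt
    · obtain ⟨s, rfl⟩ := Nat.exists_eq_add_of_le' hmt
      rw [h.phi_transition]
      calc κ ^ m ≤ κ ^ m * N := le_mul_of_one_le_right (by positivity) hN
        _ = ∑ j, κ ^ m * φ s j l := by rw [← Finset.mul_sum, h.sum_phi]
        _ ≤ _ := Finset.sum_le_sum fun j _ => mul_le_mul_of_nonneg_right (hm s i j)
            ((pow_pos hκ _).le.trans (hpos s j l))
    · exact (pow_le_pow_of_le_one hκ.le hκ1 hmt.le).trans (hpos t i l)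
  obtain ⟨C, hC, hall⟩ := exists_uniform_bound
    (P := fun l C => ∃ c : ℝ, 0 < c ∧ c⁻¹ ≤ C ∧ ∀ t i, c ≤ φ t i l)
    (fun _ _ _ hCD ⟨c, h1, h2, h3⟩ => ⟨c, h1, h2.trans hCD, h3⟩)
    (fun l => let ⟨c, h1, h2⟩ := hl l; ⟨c⁻¹, c, h1, le_rfl, h2⟩)
  refine ⟨C⁻¹, inv_pos.2 hC, fun t i l => ?_⟩
  obtain ⟨c, h1, h2, h3⟩ := hall l
  exact (inv_le_of_inv_le₀ h1 h2).trans (h3 t i)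

theorem phi_pos (h : Run f r K G sel a ft γ φ x y xt) (t i l) : 0 < φ t i l :=
  let ⟨_, hc, hle⟩ := h.exists_phi_lower_bound
  hc.trans_le (hle t i l)

theorem phi_le (h : Run f r K G sel a ft γ φ x y xt) (t i l) : φ t i l ≤ N := by
  rw [← h.sum_phi t l]
  exact Finset.single_le_sum (f := fun i => φ t i l) (fun j _ => (h.phi_pos t j l).le)
    (Finset.mem_univ i)

theorem cast_pos (h : Run f r K G sel a ft γ φ x y xt) : (0 : ℝ) < N := by
  exact_mod_cast h.agents

theorem mixing_nonneg (h : Run f r K G sel a ft γ φ x y xt) (l t i j) :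
    0 ≤ mixing a φ l t i j :=
  div_nonneg (mul_nonneg (h.weights.nonneg t l i j) (h.phi_pos t j l).le) (h.phi_pos _ i l).le

theorem mixing_row_sum (h : Run f r K G sel a ft γ φ x y xt) (l t i) :
    ∑ j, mixing a φ l t i j = 1 := by
  simp only [mixing, ← Finset.sum_div]
  rw [← h.phi_succ, div_self (h.phi_pos _ i l).ne']

/-- Perturbed consensus over the network: contraction of the spread on block `l`. -/
theorem exists_contraction (h : Run f r K G sel a ft γ φ x y xt) (l : Fin B) :
    ∃ ρ : ℝ, 0 ≤ ρ ∧ ρ < 1 ∧ ∃ m, 0 < m ∧ ∀ (z u : ℕ → Fin N → Block d) (ε : ℕ → ℝ),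
      (∀ t i, z (t + 1) i = ∑ j, mixing a φ l t i j • (z t j + u t j)) →
      (∀ t j, ‖u t j‖ ≤ ε t) →
      ∀ t, spread (z (t + m)) ≤ ρ * spread (z t) + 2 * ∑ s ∈ Finset.range m, ε (t + s) := by
  obtain ⟨κ, hκ, hlow⟩ := h.weights.lower_bound
  obtain ⟨c, hc, hφ⟩ := h.exists_phi_lower_bound
  have hN := h.cast_pos
  have : Nonempty (Fin N) := ⟨⟨0, h.agents⟩⟩
  have hedge : ∀ t i j, (blockGraph G sel t l).Adj j i → κ * c / N ≤ mixing a φ l t i j := by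
    intro t i j hadj
    exact div_le_div₀ (mul_nonneg (h.weights.nonneg t l i j) (h.phi_pos t j l).le)
      (mul_le_mul (hlow t l i j hadj).le (hφ t j l) hc.le (h.weights.nonneg t l i j))
      (h.phi_pos _ i l) (h.phi_le _ i l)
  refine exists_spread_contraction (h.mixing_nonneg l) (h.mixing_row_sum l)
    (κ := κ * c / N) (by positivity)
    (fun t i => hedge t i i (blockGraph_adj_self h.network t l i)) (R := G.Adj)
    (fun j i hadj => ?_) h.network.strongly_connected
  obtain ⟨T, hT⟩ := h.selection.exists_active l j i hadj
  refine ⟨T, fun t => ?_⟩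
  obtain ⟨s, hs, hs'⟩ := hT t
  exact ⟨s, hs, hedge _ i j hs'⟩

theorem spread_sq_summable (h : Run f r K G sel a ft γ φ x y xt) (l : Fin B)
    {z u : ℕ → Fin N → Block d} {ε : ℕ → ℝ}
    (hz : ∀ t i, z (t + 1) i = ∑ j, mixing a φ l t i j • (z t j + u t j))
    (hu : ∀ t j, ‖u t j‖ ≤ ε t) (hε : Summable fun t => ε t ^ 2) :
    Summable fun t => spread (z t) ^ 2 := by
  obtain ⟨ρ, h0, h1, m, -, hcon⟩ := h.exists_contraction l
  exact summable_sq_of_delayed_contraction (fun t => spread_nonneg (z t)) h0 h1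
    (summable_sq_const_mul 2 (summable_sq_sum (Finset.range m) fun s _ =>
      (summable_nat_add_iff s).2 hε)) (hcon z u ε hz hu)

theorem spread_bounded (h : Run f r K G sel a ft γ φ x y xt) (l : Fin B)
    {z u : ℕ → Fin N → Block d} {ε : ℝ}
    (hz : ∀ t i, z (t + 1) i = ∑ j, mixing a φ l t i j • (z t j + u t j))
    (hu : ∀ t j, ‖u t j‖ ≤ ε) : ∃ M, ∀ t, spread (z t) ≤ M := by
  obtain ⟨ρ, h0, h1, m, hm, hcon⟩ := h.exists_contraction l
  exact bounded_of_delayed_contraction hm h0 h1 (hcon z u (fun _ => ε) hz hu)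

theorem x_succ (h : Run f r K G sel a ft γ φ x y xt) (t i l) :
    x (t + 1) i l = ∑ j, mixing a φ l t i j • (x t j l + γ t • direction sel x xt t j l) := by
  rw [h.generated.step_x]
  refine Finset.sum_subset (Finset.subset_univ _) fun j _ hj => ?_
  rw [h.weights.eq_zero hj, zero_mul, zero_div, zero_smul]

/-- Puts the tracking update in the same perturbed-consensus form as `x_succ`, so that one
contraction result serves both. -/
theorem y_succ (h : Run f r K G sel a ft γ φ x y xt) (t i l) :
    y (t + 1) i l = ∑ j, mixing a φ l t i j • (y t j l
      + (φ t j l)⁻¹ • (gradient (f j) (x (t + 1) j) l - gradient (f j) (x t j) l)) := by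
  rw [h.generated.step_y]
  refine (Finset.sum_subset (Finset.subset_univ _) fun j _ hj => ?_).trans
    (Finset.sum_congr rfl fun j _ => ?_)
  · rw [h.weights.eq_zero hj, zero_div, zero_smul]
  · have hφ := (h.phi_pos t j l).ne'
    have e : y t j l + (φ t j l)⁻¹ • (gradient (f j) (x (t + 1) j) l - gradient (f j) (x t j) l)
        = (φ t j l)⁻¹ • (φ t j l • y t j l
          + gradient (f j) (x (t + 1) j) l - gradient (f j) (x t j) l) := by
      rw [add_sub_assoc, smul_add, inv_smul_smul₀ hφ]
    rw [e, smul_smul, mixing]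
    congr 1
    field_simp

/-- Column stochasticity: mixing preserves `φ`-weighted sums. -/
theorem sum_phi_mixing (h : Run f r K G sel a ft γ φ x y xt) {E : Type*} [AddCommGroup E]
    [Module ℝ E] (t l) (w : Fin N → E) :
    ∑ i, φ (t + 1) i l • ∑ j, mixing a φ l t i j • w j = ∑ j, φ t j l • w j := by
  simp only [Finset.smul_sum, smul_smul]
  rw [Finset.sum_comm]
  refine Finset.sum_congr rfl fun j _ => ?_
  rw [← Finset.sum_smul]
  congr 1
  have : ∀ i, φ (t + 1) i l * mixing a φ l t i j = a t l i j * φ t j l := fun i =>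
    mul_div_cancel₀ _ (h.phi_pos _ i l).ne'
  simp only [this, ← Finset.sum_mul, h.weights.column_stochastic, one_mul]

theorem trial_mem (h : Run f r K G sel a ft γ φ x y xt) {t j} (hx : x t j ∈ feasibleSet K) (l) :
    x t j l + γ t • direction sel x xt t j l ∈ K l := by
  unfold direction
  split_ifs with hl
  · subst hl
    have := h.problem.convex _ (hx (sel t j)) (h.generated.best_mem t j)
      (show 0 ≤ 1 - γ t by linarith [h.step.le_one t]) (h.step.pos t).le (by ring)
    convert this using 1
    rw [sub_smul, smul_sub, one_smul]; abel
  · simpa using hx l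

theorem mem_feasibleSet (h : Run f r K G sel a ft γ φ x y xt) (t i) : x t i ∈ feasibleSet K := by
  induction t generalizing i with
  | zero => exact h.generated.init_x i
  | succ t ih =>
    intro l
    rw [h.x_succ]
    exact (h.problem.convex l).sum_mem (fun j _ => h.mixing_nonneg l t i j)
      (h.mixing_row_sum l t i) fun j _ => h.trial_mem (ih j) l

theorem sum_phi_y (h : Run f r K G sel a ft γ φ x y xt) (t l) :
    ∑ i, φ t i l • y t i l = ∑ i, gradient (f i) (x t i) l := by
  induction t with
  | zero => simp [h.generated.init_phi, h.generated.init_y]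
  | succ t ih =>
    simp only [h.y_succ]
    rw [h.sum_phi_mixing]
    simp only [smul_add, smul_inv_smul₀ (h.phi_pos _ _ _).ne', Finset.sum_add_distrib, ih,
      Finset.sum_sub_distrib]
    abel

theorem weights_sum_one (h : Run f r K G sel a ft γ φ x y xt) (t l) :
    ∑ i, φ t i l / N = 1 := by
  rw [← Finset.sum_div, h.sum_phi, div_self h.cast_pos.ne']

theorem weightedAverage_apply (t : ℕ) (l : Fin B) :
    weightedAverage φ x t l = ∑ i, (φ t i l / N) • x t i l := by
  simp only [weightedAverage, Finset.smul_sum, smul_smul, one_div_mul_eq_div]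

/-- By `sum_phi_y`, N times the φ-weighted mean of the trackers is exactly the sum of local
gradients, so only disagreement among trackers contributes. -/
theorem norm_y_sub_le (h : Run f r K G sel a ft γ φ x y xt) (t i l) :
    ‖(N : ℝ) • y t i l - ∑ j, gradient (f j) (x t j) l‖ ≤ N * spread (fun i => y t i l) := by
  have h1 := norm_sub_weighted_sum_le_spread (w := fun j => φ t j l / N)
    (fun j => div_nonneg (h.phi_pos t j l).le h.cast_pos.le) (h.weights_sum_one t l)
    (fun i => y t i l) i
  have e : (N : ℝ) • y t i l - ∑ j, gradient (f j) (x t j) l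
      = (N : ℝ) • (y t i l - ∑ j, (φ t j l / N) • y t j l) := by
    rw [smul_sub, Finset.smul_sum]
    simp only [smul_smul, mul_div_cancel₀ _ h.cast_pos.ne', h.sum_phi_y]
  rw [e, norm_smul, Real.norm_of_nonneg h.cast_pos.le]
  exact mul_le_mul_of_nonneg_left h1 h.cast_pos.le

/-- Only boundedness of the gradients is used, nothing about how far `x` moves. This is the entry
point that avoids circularity between the `x` and `y` estimates. -/
theorem exists_y_bound (h : Run f r K G sel a ft γ φ x y xt) :
    ∃ C : ℝ, 0 < C ∧ ∀ l t i, ‖(N : ℝ) • y t i l‖ ≤ C := by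
  obtain ⟨A, hA, hgrad⟩ := h.problem.exists_gradient_bound
  obtain ⟨c, hc, hφ⟩ := h.exists_phi_lower_bound
  have hg : ∀ t j l, ‖gradient (f j) (x t j) l‖ ≤ A := fun t j l =>
    (PiLp.norm_apply_le _ l).trans (hgrad j _ (h.mem_feasibleSet t j))
  refine exists_uniform_bound (P := fun l C => ∀ t i, ‖(N : ℝ) • y t i l‖ ≤ C)
    (fun _ _ _ hCD hC t i => (hC t i).trans hCD) fun l => ?_
  obtain ⟨M, hM⟩ := h.spread_bounded l (z := fun t i => y t i l) (ε := c⁻¹ * (A + A))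
    (fun t i => h.y_succ t i l) (fun t j => by
      rw [norm_smul, Real.norm_of_nonneg (inv_nonneg.2 (h.phi_pos t j l).le)]
      exact mul_le_mul (inv_anti₀ hc (hφ t j l)) (norm_sub_le_of_le (hg _ _ _) (hg _ _ _))
        (norm_nonneg _) (inv_nonneg.2 hc.le))
  refine ⟨N * M + N * A, fun t i => ?_⟩
  have h1 := (h.norm_y_sub_le t i l).trans (mul_le_mul_of_nonneg_left (hM t) h.cast_pos.le)
  have h2 : ‖∑ j, gradient (f j) (x t j) l‖ ≤ N * A := by
    refine (norm_sum_le_of_le _ fun j _ => hg t j l).trans ?_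
    simp
  rw [← sub_add_cancel ((N : ℝ) • y t i l) (∑ j, gradient (f j) (x t j) l)]
  exact norm_add_le_of_le h1 h2

theorem isBlockResponse (h : Run f r K G sel a ft γ φ x y xt) (t i) :
    IsBlockResponse f r K ft i (sel t i) (x t i) ((N : ℝ) • y t i (sel t i)) (xt t i) :=
  ⟨h.generated.best_mem t i, fun _ hw => variational_inequality_of_isMinOn
    (h.generated.best_mem t i)
    (h.surrogate.differentiable i _ _ (h.mem_feasibleSet t i) _ (h.generated.best_mem t i))
    (h.problem.reg_convex _) (h.generated.best_min t i) hw⟩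

theorem exists_direction_bound (h : Run f r K G sel a ft γ φ x y xt) :
    ∃ C : ℝ, 0 < C ∧ ∀ t i l, ‖direction sel x xt t i l‖ ≤ C := by
  obtain ⟨A, hA, hy⟩ := h.exists_y_bound
  obtain ⟨C, hC, hresp⟩ := exists_response_bound h.problem h.surrogate
  refine ⟨C * (A + C), by positivity, fun t i l => ?_⟩
  unfold direction
  split_ifs with hl
  · subst hl
    refine (hresp i _ _ (h.mem_feasibleSet t i) _ _ (h.isBlockResponse t i)).trans ?_
    have := hy (sel t i) t i
    gcongr
  · rw [norm_zero]; positivity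

theorem x_spread_sq_summable (h : Run f r K G sel a ft γ φ x y xt) (l : Fin B) :
    Summable fun t => spread (fun i => x t i l) ^ 2 := by
  obtain ⟨C, hC, hdir⟩ := h.exists_direction_bound
  refine h.spread_sq_summable l (z := fun t i => x t i l) (ε := fun t => C * γ t)
    (fun t i => h.x_succ t i l) (fun t j => ?_)
    (summable_sq_const_mul C h.step.sum_sq_finite)
  rw [norm_smul, Real.norm_of_nonneg (h.step.pos t).le, mul_comm]
  exact mul_le_mul_of_nonneg_right (hdir t j l) (h.step.pos t).le

theorem weightedAverage_mem (h : Run f r K G sel a ft γ φ x y xt) (t) :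
    weightedAverage φ x t ∈ feasibleSet K := by
  intro l
  rw [weightedAverage_apply]
  exact (h.problem.convex l).sum_mem
    (fun j _ => div_nonneg (h.phi_pos t j l).le h.cast_pos.le)
    (h.weights_sum_one t l) fun j _ => h.mem_feasibleSet t j l

theorem norm_sub_weightedAverage_le (h : Run f r K G sel a ft γ φ x y xt) (t i) :
    ‖x t i - weightedAverage φ x t‖ ≤ ∑ l, spread (fun i => x t i l) := by
  refine (norm_le_sum_norm _).trans (Finset.sum_le_sum fun l _ => ?_)
  rw [PiLp.sub_apply, weightedAverage_apply]
  exact norm_sub_weighted_sum_le_spread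
    (fun j => div_nonneg (h.phi_pos t j l).le h.cast_pos.le) (h.weights_sum_one t l)
    (fun i => x t i l) i

theorem weightedAverage_succ (h : Run f r K G sel a ft γ φ x y xt) (t l) :
    weightedAverage φ x (t + 1) l - weightedAverage φ x t l
      = ∑ i, (γ t * (φ t i l / N)) • direction sel x xt t i l := by
  simp only [weightedAverage, h.x_succ]
  rw [h.sum_phi_mixing, ← smul_sub, ← Finset.sum_sub_distrib, Finset.smul_sum]
  refine Finset.sum_congr rfl fun i _ => ?_
  rw [smul_add, add_sub_cancel_left, smul_smul, smul_smul]
  congr 1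
  ring

theorem exists_weightedAverage_step_bound (h : Run f r K G sel a ft γ φ x y xt) :
    ∃ C : ℝ, 0 < C ∧
      ∀ t, ‖weightedAverage φ x (t + 1) - weightedAverage φ x t‖ ≤ C * γ t := by
  obtain ⟨C, hC, hdir⟩ := h.exists_direction_bound
  refine ⟨B * C + 1, by positivity, fun t => (norm_le_sum_norm _).trans ?_⟩
  have hγ := h.step.pos t
  have h1 : ∀ l, ‖(weightedAverage φ x (t + 1) - weightedAverage φ x t) l‖ ≤ C * γ t := by
    intro l
    rw [PiLp.sub_apply, h.weightedAverage_succ]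
    calc _ ≤ ∑ i, (γ t * (φ t i l / N)) * C := norm_sum_le_of_le _ fun i _ => by
            have h2 : 0 ≤ γ t * (φ t i l / N) :=
              mul_nonneg hγ.le (div_nonneg (h.phi_pos t i l).le h.cast_pos.le)
            rw [norm_smul, Real.norm_of_nonneg h2]
            exact mul_le_mul_of_nonneg_left (hdir t i l) h2
      _ = C * γ t := by
            rw [← Finset.sum_mul, ← Finset.mul_sum, h.weights_sum_one, mul_one, mul_comm]
  refine (Finset.sum_le_sum fun l _ => h1 l).trans ?_
  simp only [Finset.sum_const, Finset.card_univ, Fintype.card_fin, nsmul_eq_mul]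
  linarith

/-- Mixing moves the local copies by amounts not proportional to γ. Passing through the weighted
averages at both times replaces these moves by spreads, which are square summable. -/
theorem exists_x_increment_bound (h : Run f r K G sel a ft γ φ x y xt) :
    ∃ ε : ℕ → ℝ, (Summable fun t => ε t ^ 2) ∧ ∀ t i, ‖x (t + 1) i - x t i‖ ≤ ε t := by
  obtain ⟨C, hC, hstep⟩ := h.exists_weightedAverage_step_bound
  have hs : Summable fun t => (∑ l, spread (fun i => x t i l)) ^ 2 :=
    summable_sq_sum _ fun l _ => h.x_spread_sq_summable l
  refine ⟨_, summable_sq_add (summable_sq_add ((summable_nat_add_iff 1).2 hs)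
    (summable_sq_const_mul C h.step.sum_sq_finite)) hs, fun t i => ?_⟩
  have e : x (t + 1) i - x t i = (x (t + 1) i - weightedAverage φ x (t + 1))
      + (weightedAverage φ x (t + 1) - weightedAverage φ x t)
      - (x t i - weightedAverage φ x t) := by abel
  rw [e]
  exact norm_sub_le_of_le (norm_add_le_of_le (h.norm_sub_weightedAverage_le _ _) (hstep t))
    (h.norm_sub_weightedAverage_le _ _)

theorem y_spread_sq_summable (h : Run f r K G sel a ft γ φ x y xt) (l : Fin B) :
    Summable fun t => spread (fun i => y t i l) ^ 2 := by
  obtain ⟨ε, hε, hinc⟩ := h.exists_x_increment_bound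
  obtain ⟨c, hc, hφ⟩ := h.exists_phi_lower_bound
  obtain ⟨L, hL, hLip⟩ := h.problem.exists_lipschitz
  refine h.spread_sq_summable l (z := fun t i => y t i l) (ε := fun t => c⁻¹ * (L * ε t))
    (fun t i => h.y_succ t i l) (fun t j => ?_)
    (summable_sq_const_mul _ (summable_sq_const_mul L hε))
  rw [norm_smul, Real.norm_of_nonneg (inv_nonneg.2 (h.phi_pos t j l).le)]
  refine mul_le_mul (inv_anti₀ hc (hφ t j l)) ?_ (norm_nonneg _) (inv_nonneg.2 hc.le)
  exact (norm_block_sub_le _ _ l).trans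
    ((hLip j _ (h.mem_feasibleSet t j) _ (h.mem_feasibleSet (t + 1) j)).1.trans
      (mul_le_mul_of_nonneg_left (hinc t j) hL.le))

/-- Consensus and gradient tracking errors are square summable. -/
theorem exists_error (h : Run f r K G sel a ft γ φ x y xt) :
    ∃ e : ℕ → ℝ, (∀ t, 0 ≤ e t) ∧ (Summable fun t => e t ^ 2) ∧
      (∀ t i, ‖x t i - weightedAverage φ x t‖ ≤ e t) ∧
      ∀ t i l, ‖(N : ℝ) • y t i l - (∑ j, gradient (f j) (weightedAverage φ x t)) l‖ ≤ e t := by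
  obtain ⟨L, hL, hLip⟩ := h.problem.exists_lipschitz
  set X : ℕ → ℝ := fun t => ∑ l, spread (fun i => x t i l) with hX
  set Y : ℕ → ℝ := fun t => ∑ l, spread (fun i => y t i l) with hY
  have hX0 : ∀ t, 0 ≤ X t := fun t => Finset.sum_nonneg fun l _ => spread_nonneg _
  have hY0 : ∀ t, 0 ≤ Y t := fun t => Finset.sum_nonneg fun l _ => spread_nonneg _
  have hXs : Summable fun t => X t ^ 2 := summable_sq_sum _ fun l _ => h.x_spread_sq_summable l
  have hYs : Summable fun t => Y t ^ 2 := summable_sq_sum _ fun l _ => h.y_spread_sq_summable l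
  have hN := h.cast_pos
  refine ⟨fun t => X t + ((N : ℝ) * Y t + (N * L) * X t), fun t => ?_,
    summable_sq_add hXs (summable_sq_add (summable_sq_const_mul _ hYs)
      (summable_sq_const_mul _ hXs)), fun t i => ?_, fun t i l => ?_⟩
  · have := hX0 t
    have := hY0 t
    positivity
  · have h1 := h.norm_sub_weightedAverage_le t i
    have h2 : 0 ≤ (N : ℝ) * Y t + (N * L) * X t := by
      have := hX0 t
      have := hY0 t
      positivity
    linarith
  · have h1 : ‖(N : ℝ) • y t i l - ∑ j, gradient (f j) (x t j) l‖ ≤ N * Y t :=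
      (h.norm_y_sub_le t i l).trans (mul_le_mul_of_nonneg_left
        (Finset.single_le_sum (f := fun l => spread (fun i => y t i l))
          (fun _ _ => spread_nonneg _) (Finset.mem_univ l)) hN.le)
    have h2 : ‖∑ j, gradient (f j) (x t j) l
        - (∑ j, gradient (f j) (weightedAverage φ x t)) l‖ ≤ (N * L) * X t := by
      rw [blockVec_sum_apply, ← Finset.sum_sub_distrib]
      refine (norm_sum_le_of_le (f := fun j => gradient (f j) (x t j) l
        - gradient (f j) (weightedAverage φ x t) l) (n := fun _ => L * X t) _
        fun j _ => ?_).trans (by simp [mul_assoc])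
      exact (norm_block_sub_le _ _ l).trans ((hLip j _ (h.weightedAverage_mem t) _
        (h.mem_feasibleSet t j)).1.trans
          (mul_le_mul_of_nonneg_left (h.norm_sub_weightedAverage_le t j) hL.le))
    have h3 := norm_add_le_of_le h1 h2
    rw [sub_add_sub_cancel] at h3
    linarith [hX0 t]

end Run

/-! ### Lyapunov descent and boundedness. -/

/-- The Lyapunov function: the smooth part at the weighted average plus the weighted average of
the regularizers at the local copies. -/
noncomputable def lyapunov {N B d : ℕ} (f : Fin N → BlockVec B d → ℝ) (r : Fin B → Block d → ℝ)
    (φ : ℕ → Fin N → Fin B → ℝ) (x : ℕ → Fin N → BlockVec B d) (t : ℕ) : ℝ :=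
  ∑ i, f i (weightedAverage φ x t) + ∑ l, ∑ i, φ t i l / N * r l (x t i l)

/-- The change of the regularizer along the full direction on block `l`. -/
noncomputable def regIncrement {N B d : ℕ} (r : Fin B → Block d → ℝ) (sel : ℕ → Fin N → Fin B)
    (x : ℕ → Fin N → BlockVec B d) (xt : ℕ → Fin N → Block d) (t : ℕ) (i : Fin N) (l : Fin B) :
    ℝ :=
  if l = sel t i then r l (xt t i) - r l (x t i l) else 0

namespace Run

variable {N B d : ℕ} {f : Fin N → BlockVec B d → ℝ} {r : Fin B → Block d → ℝ}
  {K : Fin B → Set (Block d)} {G : Digraph (Fin N)} {sel : ℕ → Fin N → Fin B}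
  {a : ℕ → Fin B → Matrix (Fin N) (Fin N) ℝ}
  {ft : Fin N → Fin B → Block d → BlockVec B d → ℝ} {γ : ℕ → ℝ}
  {φ : ℕ → Fin N → Fin B → ℝ} {x y : ℕ → Fin N → BlockVec B d} {xt : ℕ → Fin N → Block d}

theorem reg_trial_le (h : Run f r K G sel a ft γ φ x y xt) (t i l) :
    r l (x t i l + γ t • direction sel x xt t i l)
      ≤ r l (x t i l) + γ t * regIncrement r sel x xt t i l := by
  unfold direction regIncrement
  split_ifs with hl
  · subst hl
    have := (h.problem.reg_convex _).2 (h.mem_feasibleSet t i (sel t i))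
      (h.generated.best_mem t i)
      (show 0 ≤ 1 - γ t by linarith [h.step.le_one t]) (h.step.pos t).le (by ring)
    have e : (1 - γ t) • x t i (sel t i) + γ t • xt t i
        = x t i (sel t i) + γ t • (xt t i - x t i (sel t i)) := by
      rw [sub_smul, smul_sub, one_smul]; abel
    rw [e] at this
    simp only [smul_eq_mul] at this
    linarith
  · simp

/-- Jensen with the row-stochastic weights, followed by column stochasticity, returns exactly to the
weights φ at time t: mixing costs nothing. -/
theorem sum_reg_succ_le (h : Run f r K G sel a ft γ φ x y xt) (t l) :
    ∑ i, φ (t + 1) i l / N * r l (x (t + 1) i l)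
      ≤ ∑ i, φ t i l / N * (r l (x t i l) + γ t * regIncrement r sel x xt t i l) := by
  have h1 : ∀ i, r l (x (t + 1) i l) ≤ ∑ j, mixing a φ l t i j •
      (r l (x t j l) + γ t * regIncrement r sel x xt t j l) := by
    intro i
    rw [h.x_succ]
    refine ((h.problem.reg_convex l).map_sum_le (fun j _ => h.mixing_nonneg l t i j)
      (h.mixing_row_sum l t i) fun j _ => h.trial_mem (h.mem_feasibleSet t j) l).trans
      (Finset.sum_le_sum fun j _ => ?_)
    exact mul_le_mul_of_nonneg_left (h.reg_trial_le t j l) (h.mixing_nonneg l t i j)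
  simp only [div_mul_eq_mul_div, ← Finset.sum_div]
  refine div_le_div_of_nonneg_right ?_ h.cast_pos.le
  have h2 := h.sum_phi_mixing t l fun j => r l (x t j l) + γ t * regIncrement r sel x xt t j l
  simp only [smul_eq_mul] at h1 h2
  rw [← h2]
  exact Finset.sum_le_sum fun i _ => mul_le_mul_of_nonneg_left (h1 i) (h.phi_pos _ i l).le

/-- Replacing the tracker by `v` costs the tracking error times the direction only. On unselected
blocks all terms in the direction vanish, so the bound may be summed over every block. -/
theorem direction_descent (h : Run f r K G sel a ft γ φ x y xt) {τ : ℝ}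
    (hconv : ∀ i l, ∀ x ∈ feasibleSet K, StrongConvexOn (K l) τ (fun w => ft i l w x))
    {v : Block d} {e : ℝ} {t i l} (hv : ‖(N : ℝ) • y t i l - v‖ ≤ e) :
    inner ℝ v (direction sel x xt t i l) + regIncrement r sel x xt t i l
      ≤ -(τ * ‖direction sel x xt t i l‖ ^ 2) + e * ‖direction sel x xt t i l‖ := by
  unfold direction regIncrement
  split_ifs with hl
  · subst hl
    have h1 := (h.isBlockResponse t i).descent h.surrogate hconv (h.mem_feasibleSet t i)
    have h2 := (real_inner_le_norm (v - (N : ℝ) • y t i (sel t i))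
      (xt t i - x t i (sel t i))).trans
      (mul_le_mul_of_nonneg_right ((norm_sub_rev _ _).trans_le hv) (norm_nonneg _))
    rw [inner_sub_left] at h2
    linarith
  · simp

theorem exists_lyapunov_descent (h : Run f r K G sel a ft γ φ x y xt) :
    ∃ c : ℝ, 0 < c ∧ ∃ b : ℕ → ℝ, (∀ t, 0 ≤ b t) ∧ Summable b ∧
      ∀ t, lyapunov f r φ x (t + 1) ≤ lyapunov f r φ x t
        - γ t * (c * ∑ l, ∑ i, ‖direction sel x xt t i l‖ ^ 2) + b t := by
  obtain ⟨L, hL, hLip⟩ := h.problem.exists_lipschitz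
  obtain ⟨D, hD, hdir⟩ := h.exists_direction_bound
  obtain ⟨S, hS, hstep⟩ := h.exists_weightedAverage_step_bound
  obtain ⟨e, he0, hes, -, hey⟩ := h.exists_error
  obtain ⟨τ, hτ, hconv⟩ := h.surrogate.exists_modulus
  obtain ⟨c, hc, hφ⟩ := h.exists_phi_lower_bound
  have hN := h.cast_pos
  -- The error has two sources: tracking error times direction, giving γ e, and the second-order
  -- remainder of the smooth part, giving γ². Both are summable because γ and e are square summable.
  refine ⟨c / N * τ, by positivity, fun t => B * D * (γ t * e t) + N * L * S ^ 2 * γ t ^ 2,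
    fun t => ?_, ((summable_mul_of_sq (fun t => (h.step.pos t).le) he0 h.step.sum_sq_finite
      hes).mul_left _).add (h.step.sum_sq_finite.mul_left _), fun t => ?_⟩
  · have := (h.step.pos t).le
    have := he0 t
    positivity
  set s := weightedAverage φ x t with hs
  set s' := weightedAverage φ x (t + 1) with hs'
  have hγ := h.step.pos t
  have hsmooth : ∑ i, f i s' ≤ ∑ i, f i s + inner ℝ (∑ i, gradient (f i) s) (s' - s)
      + N * L * S ^ 2 * γ t ^ 2 := by
    have h1 : ∀ i, f i s' ≤ f i s + inner ℝ (gradient (f i) s) (s' - s)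
        + L * S ^ 2 * γ t ^ 2 := by
      intro i
      have h2 := le_of_abs_le
        (hLip i s (h.weightedAverage_mem t) s' (h.weightedAverage_mem (t + 1))).2
      have h3 : L * ‖s' - s‖ ^ 2 ≤ L * (S * γ t) ^ 2 := by
        have := hstep t
        gcongr
      linarith
    refine (Finset.sum_le_sum fun i _ => h1 i).trans (le_of_eq ?_)
    rw [Finset.sum_add_distrib, Finset.sum_add_distrib, sum_inner]
    simp only [Finset.sum_const, Finset.card_univ, Fintype.card_fin, nsmul_eq_mul]
    ring
  have hinner : inner ℝ (∑ i, gradient (f i) s) (s' - s) = ∑ l, ∑ i, γ t * (φ t i l / N)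
      * inner ℝ ((∑ j, gradient (f j) s) l) (direction sel x xt t i l) := by
    rw [PiLp.inner_apply]
    refine Finset.sum_congr rfl fun l _ => ?_
    rw [PiLp.sub_apply, hs, hs', h.weightedAverage_succ, inner_sum]
    simp only [inner_smul_right]
  have hreg := Finset.sum_le_sum fun l (_ : l ∈ Finset.univ) => h.sum_reg_succ_le t l
  have hpair : ∀ l i, γ t * (φ t i l / N)
        * inner ℝ ((∑ j, gradient (f j) s) l) (direction sel x xt t i l)
      + φ t i l / N * (r l (x t i l) + γ t * regIncrement r sel x xt t i l)
      ≤ φ t i l / N * r l (x t i l) - γ t * (c / N * τ * ‖direction sel x xt t i l‖ ^ 2)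
        + φ t i l / N * (D * (γ t * e t)) := by
    intro l i
    have h1 := h.direction_descent hconv (hey t i l)
    have h2 : e t * ‖direction sel x xt t i l‖ ≤ e t * D :=
      mul_le_mul_of_nonneg_left (hdir t i l) (he0 t)
    have hw : 0 ≤ φ t i l / N := div_nonneg (h.phi_pos t i l).le hN.le
    have h3 := mul_le_mul_of_nonneg_left (h1.trans (add_le_add_right h2 _)) (mul_nonneg hγ.le hw)
    have h4 : γ t * (c / N * τ * ‖direction sel x xt t i l‖ ^ 2)
        ≤ γ t * (φ t i l / N * τ * ‖direction sel x xt t i l‖ ^ 2) := by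
      have := hφ t i l
      gcongr
    linarith
  have hsum := Finset.sum_le_sum fun l (_ : l ∈ Finset.univ) =>
    Finset.sum_le_sum fun i (_ : i ∈ Finset.univ) => hpair l i
  simp only [Finset.sum_add_distrib, Finset.sum_sub_distrib, ← Finset.sum_mul, ← Finset.mul_sum,
    h.weights_sum_one, Finset.sum_const, Finset.card_univ, Fintype.card_fin, nsmul_eq_mul,
    mul_one] at hsum
  simp only [mul_add, Finset.sum_add_distrib] at hreg hsum
  simp only [lyapunov, ← hs, ← hs']
  rw [hinner] at hsmooth
  simp only [mul_assoc, ← Finset.mul_sum] at hsum hreg hsmooth ⊢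
  linarith

/-- By Jensen; it carries the lower bound of the objective to `lyapunov`, and the upper bound of
`lyapunov` back to the objective, where coercivity applies. -/
theorem objective_le_lyapunov (h : Run f r K G sel a ft γ φ x y xt) (t) :
    objective f r (weightedAverage φ x t) ≤ lyapunov f r φ x t := by
  refine add_le_add le_rfl (Finset.sum_le_sum fun l _ => ?_)
  rw [weightedAverage_apply]
  exact (h.problem.reg_convex l).map_sum_le
    (fun j _ => div_nonneg (h.phi_pos t j l).le h.cast_pos.le)
    (h.weights_sum_one t l) fun j _ => h.mem_feasibleSet t j l

theorem summable_direction_and_lyapunov_bounded (h : Run f r K G sel a ft γ φ x y xt) :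
    (∀ i l, Summable fun t => γ t * ‖direction sel x xt t i l‖ ^ 2) ∧
      ∃ M, ∀ t, lyapunov f r φ x t ≤ M := by
  obtain ⟨c, hc, b, hb0, hb, hdesc⟩ := h.exists_lyapunov_descent
  obtain ⟨m, hm⟩ := h.problem.exists_objective_lower_bound
  have hnn : ∀ t, 0 ≤ ∑ l, ∑ i, ‖direction sel x xt t i l‖ ^ 2 := fun t => by positivity
  obtain ⟨hsum, hM⟩ := summable_and_bounded_of_descent
    (fun t => mul_nonneg (h.step.pos t).le (mul_nonneg hc.le (hnn t))) hb0 hb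
    (fun t => (hm _ (h.weightedAverage_mem t)).trans (h.objective_le_lyapunov t)) hdesc
  refine ⟨fun i l => Summable.of_nonneg_of_le
    (fun t => mul_nonneg (h.step.pos t).le (sq_nonneg _)) (fun t => ?_) (hsum.mul_left c⁻¹), hM⟩
  have h1 : ‖direction sel x xt t i l‖ ^ 2 ≤ ∑ i, ‖direction sel x xt t i l‖ ^ 2 :=
    Finset.single_le_sum (f := fun i => ‖direction sel x xt t i l‖ ^ 2)
      (fun _ _ => sq_nonneg _) (Finset.mem_univ i)
  have h2 : ∑ i, ‖direction sel x xt t i l‖ ^ 2 ≤ ∑ l, ∑ i, ‖direction sel x xt t i l‖ ^ 2 :=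
    Finset.single_le_sum (f := fun l => ∑ i, ‖direction sel x xt t i l‖ ^ 2)
      (fun _ _ => Finset.sum_nonneg fun _ _ => sq_nonneg _) (Finset.mem_univ l)
  have e : c⁻¹ * (γ t * (c * ∑ l, ∑ i, ‖direction sel x xt t i l‖ ^ 2))
      = γ t * ∑ l, ∑ i, ‖direction sel x xt t i l‖ ^ 2 := by
    field_simp
  rw [e]
  exact mul_le_mul_of_nonneg_left (h1.trans h2) (h.step.pos t).le

theorem isBounded_range_weightedAverage (h : Run f r K G sel a ft γ φ x y xt) :
    Bornology.IsBounded (Set.range (weightedAverage φ x)) := by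
  obtain ⟨-, M, hM⟩ := h.summable_direction_and_lyapunov_bounded
  refine (h.problem.isBounded_sublevel M).subset ?_
  rintro _ ⟨t, rfl⟩
  exact ⟨h.weightedAverage_mem t, (h.objective_le_lyapunov t).trans (hM t)⟩

theorem tendsto_consensus (h : Run f r K G sel a ft γ φ x y xt) (i) :
    Tendsto (fun t => ‖x t i - weightedAverage φ x t‖) atTop (𝓝 0) := by
  obtain ⟨e, -, hes, hex, -⟩ := h.exists_error
  exact squeeze_zero (fun _ => norm_nonneg _) (fun t => hex t i) (tendsto_zero_of_summable_sq hes)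

/-! ### Vanishing residuals and stationarity of limit points. -/

theorem step_antitone (h : Run f r K G sel a ft γ φ x y xt) : Antitone γ :=
  antitone_nat_of_succ_le h.step.decreasing

theorem norm_weightedAverage_add_sub_le {S : ℝ}
    (hstep : ∀ t, ‖weightedAverage φ x (t + 1) - weightedAverage φ x t‖ ≤ S * γ t) (t k : ℕ) :
    ‖weightedAverage φ x (t + k) - weightedAverage φ x t‖
      ≤ ∑ s ∈ Finset.range k, S * γ (t + s) := by
  induction k with
  | zero => simp
  | succ k ih =>
    rw [Finset.sum_range_succ, ← add_assoc, ← sub_add_sub_cancel _ (weightedAverage φ x (t + k))]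
    exact (norm_add_le_of_le (hstep (t + k)) ih).trans (add_comm _ _).le

/-- The exact responses of an agent at the weighted averages approach these averages. -/
theorem tendsto_response (h : Run f r K G sel a ft γ φ x y xt) (i : Fin N) (l : Fin B)
    {z : BlockVec B d → Block d} (hz : ∀ s ∈ feasibleSet K,
      IsBlockResponse f r K ft i l s ((∑ j, gradient (f j) s) l) (z s)) {C : ℝ} (hC : 0 ≤ C)
    (hlip : ∀ s ∈ feasibleSet K, ∀ s' ∈ feasibleSet K,
      ‖(z s' - s' l) - (z s - s l)‖ ≤ C * ‖s' - s‖) :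
    Tendsto (fun t => ‖z (weightedAverage φ x t) - weightedAverage φ x t l‖) atTop (𝓝 0) := by
  obtain ⟨S, hS, hstep⟩ := h.exists_weightedAverage_step_bound
  obtain ⟨e, he0, hes, hex, hey⟩ := h.exists_error
  obtain ⟨R, hR, hresp⟩ := exists_response_lipschitz h.problem h.surrogate
  obtain ⟨hdir, -⟩ := h.summable_direction_and_lyapunov_bounded
  obtain ⟨T, -, hT⟩ := h.selection i
  set D : ℕ → Block d := fun t => z (weightedAverage φ x t) - weightedAverage φ x t l with hD
  set E : ℕ → ℝ := fun t => (R * 2 + 1) * e t + C * S * γ t with hE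
  have hEs : Summable fun t => E t ^ 2 :=
    summable_sq_add (summable_sq_const_mul _ hes) (summable_sq_const_mul _ h.step.sum_sq_finite)
  -- The computed and exact responses differ by at most R (e + e), from the base point and the
  -- gradient estimate; the remaining e is the gap between the agent's block and the average's.
  have hactive : ∀ t, sel t i = l →
      ‖D t‖ ≤ ‖direction sel x xt t i l‖ + (R * 2 + 1) * e t := by
    intro t ht
    have hmem := h.weightedAverage_mem t
    have h1 := hresp i l _ (h.mem_feasibleSet t i) _ hmem _ _ _ _
      (by simpa only [ht] using h.isBlockResponse t i) (hz _ hmem)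
    have h2 := hex t i
    have h3 : R * (‖weightedAverage φ x t - x t i‖
        + ‖(∑ j, gradient (f j) (weightedAverage φ x t)) l - (N : ℝ) • y t i l‖)
        ≤ R * (e t + e t) := by
      have h4 := hey t i l
      rw [norm_sub_rev] at h2 h4
      gcongr
    have h5 := (norm_block_sub_le (x t i) (weightedAverage φ x t) l).trans h2
    have e1 : D t = direction sel x xt t i l - (xt t i - z (weightedAverage φ x t))
        + (x t i l - weightedAverage φ x t l) := by
      simp only [hD, direction, ht, if_true]
      abel
    rw [e1]
    refine (norm_add_le_of_le (norm_sub_le_of_le le_rfl (h1.trans h3)) h5).trans (le_of_eq ?_)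
    ring
  -- The residual at the end of the window is compared with an earlier activation inside it. Using
  -- the end makes γ (t + T) at most every step-size in the window, so the weights can be exchanged
  -- below.
  have hwindow : ∀ t, ‖D (t + T)‖
      ≤ ∑ s ∈ Finset.range T, (‖direction sel x xt (t + s) i l‖ + E (t + s)) := by
    intro t
    obtain ⟨s, hs, hsel⟩ := hT t l
    obtain ⟨k, rfl⟩ := Nat.exists_eq_add_of_le hs.le
    have h1 := hactive _ hsel
    have h2 : ‖D (t + (s + k)) - D (t + s)‖
        ≤ C * ‖weightedAverage φ x (t + (s + k)) - weightedAverage φ x (t + s)‖ :=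
      hlip _ (h.weightedAverage_mem _) _ (h.weightedAverage_mem _)
    have h3 : ‖weightedAverage φ x (t + (s + k)) - weightedAverage φ x (t + s)‖
        ≤ ∑ q ∈ Finset.range (s + k), S * γ (t + q) := by
      rw [← add_assoc]
      refine (norm_weightedAverage_add_sub_le hstep (t + s) k).trans ?_
      rw [Finset.sum_range_add]
      simp only [add_assoc]
      exact le_add_of_nonneg_left
        (Finset.sum_nonneg fun q _ => mul_nonneg hS.le (h.step.pos _).le)
    have h4 : ‖direction sel x xt (t + s) i l‖ + (R * 2 + 1) * e (t + s)
        ≤ ∑ q ∈ Finset.range (s + k),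
          (‖direction sel x xt (t + q) i l‖ + (R * 2 + 1) * e (t + q)) :=
      Finset.single_le_sum
        (f := fun q => ‖direction sel x xt (t + q) i l‖ + (R * 2 + 1) * e (t + q))
        (fun q _ => by have := he0 (t + q); positivity) (Finset.mem_range.2 hs)
    have h5 := norm_le_norm_add_norm_sub' (D (t + (s + k))) (D (t + s))
    have h6 := mul_le_mul_of_nonneg_left h3 hC
    rw [Finset.mul_sum] at h6
    have h7 : ∑ q ∈ Finset.range (s + k), (‖direction sel x xt (t + q) i l‖ + E (t + q))
        = ∑ q ∈ Finset.range (s + k),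
            (‖direction sel x xt (t + q) i l‖ + (R * 2 + 1) * e (t + q))
          + ∑ q ∈ Finset.range (s + k), C * (S * γ (t + q)) := by
      rw [← Finset.sum_add_distrib]
      exact Finset.sum_congr rfl fun q _ => by simp only [hE]; ring
    rw [h7]
    linarith
  have hsum : Summable fun t => γ t * ‖D t‖ ^ 2 := by
    rw [← summable_nat_add_iff T]
    have hs : Summable fun t => ∑ s ∈ Finset.range T,
        (γ (t + s) * ‖direction sel x xt (t + s) i l‖ ^ 2 + E (t + s) ^ 2) :=
      summable_sum fun s _ => ((summable_nat_add_iff s).2 (hdir i l)).add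
        ((summable_nat_add_iff s).2 hEs)
    refine Summable.of_nonneg_of_le (fun t => mul_nonneg (h.step.pos _).le (sq_nonneg _))
      (fun t => ?_) (hs.mul_left ((T : ℝ) * 2))
    have h1 := (pow_le_pow_left₀ (norm_nonneg _) (hwindow t) 2).trans sq_sum_le_card_mul_sum_sq
    rw [Finset.card_range] at h1
    refine (mul_le_mul_of_nonneg_left h1 (h.step.pos _).le).trans ?_
    rw [mul_left_comm, mul_assoc]
    refine mul_le_mul_of_nonneg_left ?_ (Nat.cast_nonneg _)
    rw [Finset.mul_sum, Finset.mul_sum]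
    refine Finset.sum_le_sum fun s hs => ?_
    have hγ1 : γ (t + T) ≤ γ (t + s) :=
      h.step_antitone (by have := Finset.mem_range.1 hs; omega)
    have hγ0 := (h.step.pos (t + T)).le
    have hγ2 := h.step.le_one (t + T)
    set p := ‖direction sel x xt (t + s) i l‖
    calc γ (t + T) * (p + E (t + s)) ^ 2
        ≤ γ (t + T) * (2 * (p ^ 2 + E (t + s) ^ 2)) := by
          refine mul_le_mul_of_nonneg_left ?_ hγ0
          nlinarith [sq_nonneg (p - E (t + s))]
      _ = 2 * (γ (t + T) * p ^ 2 + γ (t + T) * E (t + s) ^ 2) := by ring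
      _ ≤ 2 * (γ (t + s) * p ^ 2 + 1 * E (t + s) ^ 2) := by gcongr
      _ = _ := by ring
  refine tendsto_zero_of_weighted_sq_summable (C := C * S) (fun t => (h.step.pos t).le)
    h.step.le_one h.step.sum_infinite h.step.sum_sq_finite (fun _ => norm_nonneg _) hsum
    fun t => ?_
  refine (abs_norm_sub_norm_le _ _).trans ((hlip _ (h.weightedAverage_mem t) _
    (h.weightedAverage_mem (t + 1))).trans ?_)
  rw [mul_assoc]
  exact mul_le_mul_of_nonneg_left (hstep t) hC

theorem isStationary_of_mapClusterPt (h : Run f r K G sel a ft γ φ x y xt) {s : BlockVec B d}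
    (hs : MapClusterPt s atTop (weightedAverage φ x)) : IsStationary f r K s := by
  have hsK : s ∈ feasibleSet K :=
    (isClosed_feasibleSet h.problem.closed).mem_of_mapClusterPt hs
      (Eventually.of_forall h.weightedAverage_mem)
  have i : Fin N := ⟨0, h.agents⟩
  refine isStationary_of_response h.problem h.surrogate i hsK fun l => ?_
  have hex : ∀ s ∈ feasibleSet K, ∃ z,
      IsBlockResponse f r K ft i l s ((∑ j, gradient (f j) s) l) z := fun s hs =>
    exists_isBlockResponse h.problem h.surrogate i l hs _
  choose! z hz using hex
  obtain ⟨R, hR, hresp⟩ := exists_response_lipschitz h.problem h.surrogate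
  obtain ⟨L, hL, hLip⟩ := h.problem.exists_lipschitz
  -- A change of s moves the response through its base point and through the total gradient, whence
  -- R (1 + N L); the final 1 accounts for the block s l itself.
  have hlip : ∀ s ∈ feasibleSet K, ∀ s' ∈ feasibleSet K,
      ‖(z s' - s' l) - (z s - s l)‖ ≤ (R * (1 + N * L) + 1) * ‖s' - s‖ := by
    intro s hs s' hs'
    have h1 := hresp i l s hs s' hs' _ _ _ _ (hz s hs) (hz s' hs')
    have h2 : ‖(∑ j, gradient (f j) s') l - (∑ j, gradient (f j) s) l‖ ≤ N * L * ‖s' - s‖ := by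
      refine (norm_block_sub_le _ _ l).trans ?_
      rw [← Finset.sum_sub_distrib]
      refine (norm_sum_le_of_le _ fun j _ => (hLip j s hs s' hs').1).trans ?_
      simp [mul_assoc]
    have h3 := mul_le_mul_of_nonneg_left (add_le_add_right h2 ‖s' - s‖) hR.le
    have e : (z s' - s' l) - (z s - s l) = (z s' - z s) - (s' l - s l) := by abel
    rw [e]
    rw [norm_sub_rev] at h1
    refine (norm_sub_le_of_le (h1.trans h3) (norm_block_sub_le s' s l)).trans (le_of_eq ?_)
    ring
  have hlim := h.tendsto_response i l hz (by positivity) hlip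
  -- The residual is continuous on `K` and tends to zero along the averages, which return
  -- arbitrarily close to s.
  have hzero : z s = s l := by
    rw [← sub_eq_zero, ← norm_le_zero_iff]
    refine le_of_forall_pos_le_add fun ε hε => ?_
    set C := R * (1 + N * L) + 1 with hCdef
    have hC : 0 < C := by positivity
    have h1 : ∃ᶠ t in atTop, weightedAverage φ x t ∈ Metric.ball s (ε / (2 * C)) :=
      hs.frequently (Metric.ball_mem_nhds s (by positivity))
    obtain ⟨t, ht1, ht2⟩ := (h1.and_eventually (hlim.eventually_lt_const (half_pos hε))).exists
    rw [Metric.mem_ball, dist_comm, dist_eq_norm] at ht1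
    have h2 := hlip _ (h.weightedAverage_mem t) s hsK
    have h3 := mul_le_mul_of_nonneg_left ht1.le hC.le
    have h4 : C * (ε / (2 * C)) = ε / 2 := by field_simp
    have h5 := norm_le_norm_add_norm_sub' (z s - s l)
      (z (weightedAverage φ x t) - weightedAverage φ x t l)
    linarith
  have := hz s hsK
  rwa [hzero] at this

end Run

end BlockOpt

theorem theorem1 {N B d : ℕ} (hN : 0 < N)
    (f : Fin N → BlockOpt.BlockVec B d → ℝ) (r : Fin B → BlockOpt.Block d → ℝ)
    (K : Fin B → Set (BlockOpt.Block d)) (G : Digraph (Fin N)) (sel : ℕ → Fin N → Fin B)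
    (a : ℕ → Fin B → Matrix (Fin N) (Fin N) ℝ)
    (ft : Fin N → Fin B → BlockOpt.Block d → BlockOpt.BlockVec B d → ℝ) (γ : ℕ → ℝ)
    (φ : ℕ → Fin N → Fin B → ℝ) (x y : ℕ → Fin N → BlockOpt.BlockVec B d)
    (xt : ℕ → Fin N → BlockOpt.Block d)
    (hproblem : BlockOpt.ProblemAssumptions f r K)
    (hnetwork : BlockOpt.NetworkAssumptions G)
    (hweights : BlockOpt.WeightAssumptions G sel a)
    (hselection : BlockOpt.EssentiallyCyclic sel)
    (hsurrogate : BlockOpt.SurrogateAssumptions f K ft)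
    (hstep : BlockOpt.StepAssumptions γ)
    (hgen : BlockOpt.IsGenerated f r K G sel a ft γ φ x y xt) :
    (∀ i, Tendsto (fun t => ‖x t i - BlockOpt.weightedAverage φ x t‖) atTop (𝓝 0)) ∧
    Bornology.IsBounded (Set.range (BlockOpt.weightedAverage φ x)) ∧
    ∀ s : BlockOpt.BlockVec B d,
      MapClusterPt s atTop (BlockOpt.weightedAverage φ x) → BlockOpt.IsStationary f r K s := by
  have h : BlockOpt.Run f r K G sel a ft γ φ x y xt :=
    ⟨hN, hproblem, hnetwork, hweights, hselection, hsurrogate, hstep, hgen⟩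
  exact ⟨h.tendsto_consensus, h.isBounded_range_weightedAverage,
    fun _ hs => h.isStationary_of_mapClusterPt hs⟩
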